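/- Assume CH. Call a topological space $X$ \emph{relevant} if it is regular (and $T_1$), first countable, countably compact, not compact, of cardinality $\aleph_1$, and has no uncountable free sequence, i.e. there is no sequence $(x_\alpha:\alpha<\omega_1)$ in $X$ such that $\overline{\{x_\beta:\beta<\alpha\}}\cap\overline{\{x_\beta:\beta\ge\alpha\}}=\emptyset$ for all $\alpha<\omega_1$. Let $\mathcal X=\{X_\xi:\xi<\kappa\}$ be a family of relevant spaces, and for each $\xi<\kappa$ fix the following: (a) a maximal filter $\mathcal U_\xi$ of closed subsets of $X_\xi$ with $\bigcap\mathcal U_\xi=\emptyset$; (b) a set $Y_\xi\subseteq X_\xi$ that diagonalizes $\mathcal U_\xi$ (it meets every $A\in\mathcal U_\xi$, and $Y_\xi\setminus A$ is countable for every $A\in\mathcal U_\xi$), together with a bijection of $\omega_1$ with $Y_\xi$ under which initial segments of $\omega_1$ are open in $Y_\xi$; through it every $\alpha<\omega_1$ is regarded as a point of $X_\xi$; (c) for each $\alpha<\omega_1$, a decreasing base $\{\mathcal B(X_\xi,\alpha,n):n\in\omega\}$ of open neighbourhoods of $\alpha$ in $X_\xi$. A \emph{promise} is a function $f$ from an uncountable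 subset of $\omega_1$ to $\omega$. For $v\subseteq\kappa$ finite let $X_v=\prod_{\xi\in v}X_\xi$, and let $\mathcal U_v$ be the filter of closed subsets of $X_v$ generated by the products $\prod_{\xi\in v}A_\xi$ with $A_\xi\in\mathcal U_\xi$. For a promise $f$ let $\mathrm{Ban}(v,f)$ be the set of all $(x_\xi)_{\xi\in v}\in X_v$ such that $\{\alpha\in\operatorname{dom}f:\forall\xi\in v\ \ x_\xi\in\mathcal B(X_\xi,\alpha,f(\alpha))\}$ is countable. The set $v$ is \emph{dangerous} if for some promise $f$ the set $\mathrm{Ban}(v,f)$ meets every member of $\mathcal U_v$; the family $\mathcal X$ is \emph{safe} if no finite $v\subseteq\kappa$ is dangerous. The conditions of the notion of forcing $P(\mathcal X)$ are the pairs $p=(a_p,\Phi_p)$ where $a_p$ is a function into $\{0,1\}$ whose domain is a countable subset of $\{(\xi,x):\xi<\kappa,\ x\in X_\xi\}$, such that $\overline{[p]_\xi}\notin\mathcal U_\xi$ for each $\xi<\kappa$, where $[p]_\xi=\{x\in X_\xi:a_p(\xi,x)=1\}$, and $\Phi_p$ is a countable set of pairs $(v,f)$ with $v\subseteq\kappa$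 finite and $f$ a promise. A condition $q$ extends $p$ ($q\le p$) if $a_q\supseteq a_p$, $\Phi_q\supseteq\Phi_p$, and for every $(v,f)\in\Phi_p$ the set $$Y(v,f,q,p)=\{\alpha\in\operatorname{dom}f:\forall\xi\in v\ \ [q]_\xi\setminus[p]_\xi\subseteq\mathcal B(X_\xi,\alpha,f(\alpha))\}$$ is uncountable and $(v,f\restriction Y(v,f,q,p))\in\Phi_q$. A notion of forcing $P$ is \emph{totally proper} if for every sufficiently large regular cardinal $\lambda$, every countable elementary submodel $N$ of $H(\lambda)$ with $P\in N$ and every $p\in N\cap P$, there is a decreasing sequence $(p_n:n\in\omega)$ of elements of $N\cap P$ with $p_0=p$ that meets every dense open subset of $P$ belonging to $N$ and that has a lower bound in $P$. \textbf{Theorem.} If $\mathcal X$ is safe, then $P(\mathcal X)$ is totally proper. -/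

import Mathlib

universe u

open Set Filter Topology

/-! ### Set-theoretic preliminaries: `H(λ)`, elementary submodels, total properness -/

/-- The first uncountable ordinal, as a (well-ordered) type. -/
abbrev Omega1 : Type := (Ordinal.omega 1 : Ordinal.{0}).ToType

/-- The only symbol of the language of set theory: the binary relation symbol for membership. -/
inductive MemRel : ℕ → Type
  | mem : MemRel 2

/-- The first-order language of set theory. -/
def setLang : FirstOrder.Language.{0, 0} where
  Functions := fun _ => Empty
  Relations := MemRel

/-- `H(lam)`: the sets whose transitive closure has cardinality less than `lam`, i.e. those
included in a transitive set of cardinality less than `lam`. -/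
def HSet (lam : Cardinal.{u}) : Set ZFSet.{u} :=
  {x | ∃ t : ZFSet.{u}, t.IsTransitive ∧ x ⊆ t ∧ t.card < lam}

/-- `H(lam)` is a structure for the language of set theory, with the true membership relation. -/
instance instStructureHSet (lam : Cardinal.{u}) : setLang.Structure (HSet lam) where
  funMap := fun f => Empty.elim f
  RelMap := fun {_} r => match r with
    | MemRel.mem => fun x => (x 0 : ZFSet.{u}) ∈ (x 1 : ZFSet.{u})

/-- An elementary submodel of `H(lam)`, regarded as a collection of sets. -/
def submodelSets {lam : Cardinal.{u}} (N : setLang.ElementarySubstructure (HSet lam)) :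
    Set ZFSet.{u} :=
  Subtype.val '' (N : Set (HSet lam))

section Forcing

variable {P : Type u} [Preorder P]

/-- `D` is a dense open subset of the notion of forcing `P` (`q ≤ p` means: `q` extends `p`). -/
def IsDenseOpen (D : Set P) : Prop :=
  (∀ p, ∃ q ∈ D, q ≤ p) ∧ IsLowerSet D

/-- The set `{c p : p ∈ D}`. -/
noncomputable def codeSubset (c : P → ZFSet.{u}) (D : Set P) : ZFSet.{u} :=
  ZFSet.range (fun p : D => c p)

/-- The copy of the notion of forcing `(P, ≤)` along an injection `c` of `P` into the universe of
sets: the ordered pair of its underlying set and of its order, a set of ordered pairs. -/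
noncomputable def codeForcing (c : P → ZFSet.{u}) : ZFSet.{u} :=
  ZFSet.pair (codeSubset c univ)
    (ZFSet.range (fun r : {r : P × P // r.1 ≤ r.2} => ZFSet.pair (c r.1.1) (c r.1.2)))

/-- `s` is an `(N, P)`-generic sequence; `P` is regarded as a set through `c`. -/
def IsGenericSequence (c : P → ZFSet.{u}) {lam : Cardinal.{u}}
    (N : setLang.ElementarySubstructure (HSet lam)) (s : ℕ → P) : Prop :=
  (∀ n, c (s n) ∈ submodelSets N) ∧ (∀ n, s (n + 1) ≤ s n) ∧
    ∀ D : Set P, IsDenseOpen D → codeSubset c D ∈ submodelSets N → ∃ n, s n ∈ D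

variable (P) in
/-- Total properness: for every copy of `P` in the universe of sets, every large enough regular
`lam`, every countable elementary submodel `N` of `H(lam)` that contains (the copy of) `P`, and
every `p ∈ N ∩ P`, some `(N, P)`-generic sequence starting at `p` has a lower bound. -/
def TotallyProper : Prop :=
  ∀ c : P → ZFSet.{u}, Function.Injective c →
    ∃ lam₀ : Cardinal.{u}, ∀ lam : Cardinal.{u}, lam₀ ≤ lam → lam.IsRegular →
      ∀ N : setLang.ElementarySubstructure (HSet lam), (submodelSets N).Countable →
        codeForcing c ∈ submodelSets N →
          ∀ p : P, c p ∈ submodelSets N →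
            ∃ s : ℕ → P, s 0 = p ∧ IsGenericSequence c N s ∧ ∃ q : P, ∀ n, q ≤ s n

end Forcing

/-! ### Filters of closed sets and relevant spaces -/

section Spaces

variable {X : Type u} [TopologicalSpace X]

/-- A (proper) filter of closed subsets of `X`. -/
structure IsClosedFilter (U : Set (Set X)) : Prop where
  isClosed : ∀ A ∈ U, IsClosed A
  univ_mem : univ ∈ U
  empty_notMem : ∅ ∉ U
  inter_mem : ∀ A ∈ U, ∀ B ∈ U, A ∩ B ∈ U
  mem_of_superset : ∀ A ∈ U, ∀ B, IsClosed B → A ⊆ B → B ∈ U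

/-- A maximal filter of closed subsets of `X`. -/
def IsMaximalClosedFilter (U : Set (Set X)) : Prop :=
  IsClosedFilter U ∧ ∀ V : Set (Set X), IsClosedFilter V → U ⊆ V → V = U

/-- `Y` is `U`-large: it meets every member of `U`. -/
def IsLargeFor (U : Set (Set X)) (Y : Set X) : Prop :=
  ∀ A ∈ U, (Y ∩ A).Nonempty

/-- `Y` diagonalizes `U`. -/
def Diagonalizes (U : Set (Set X)) (Y : Set X) : Prop :=
  IsLargeFor U Y ∧ ∀ A ∈ U, (Y \ A).Countable

/-- A free sequence of length `ω₁`. -/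
def IsFreeSequence (x : Omega1 → X) : Prop :=
  ∀ α, Disjoint (closure (x '' Iio α)) (closure (x '' Ici α))

variable (X) in
/-- Relevant spaces. (Every uncountable free sequence has one of length `ω₁` as an initial
segment.) -/
structure IsRelevant : Prop where
  firstCountable : FirstCountableTopology X
  countablyCompact : CountablyCompactSpace X
  not_compact : ¬ CompactSpace X
  regular : T3Space X
  card_eq : Cardinal.mk X = Cardinal.aleph 1
  no_free : ¬ ∃ x : Omega1 → X, IsFreeSequence x

variable (X) in
/-- The objects that are fixed for a relevant space `X`: a maximal filter `U` of closed sets that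
is not fixed, a set `range y` that diagonalizes `U` and is identified with `ω₁` in such a way that
initial segments are open in it, and decreasing bases `B α` of (open) neighbourhoods in `X` of the
points `y α`. -/
structure SpaceData where
  U : Set (Set X)
  U_max : IsMaximalClosedFilter U
  U_free : ⋂₀ U = ∅
  y : Omega1 → X
  y_inj : Function.Injective y
  y_diag : Diagonalizes U (range y)
  y_initial : ∀ α, ∃ O : Set X, IsOpen O ∧ O ∩ range y = y '' Iio α
  B : Omega1 → ℕ → Set X
  B_open : ∀ α n, IsOpen (B α n)
  B_basis : ∀ α, (𝓝 (y α)).HasAntitoneBasis (B α)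

end Spaces

/-! ### Promises -/

/-- The domain of a partial function from `ω₁` to `ω`. -/
def pdom (f : Omega1 → Option ℕ) : Set Omega1 := {α | ∃ n, f α = some n}

/-- A promise: a partial function from `ω₁` to `ω` with uncountable domain. -/
def IsPromise (f : Omega1 → Option ℕ) : Prop := ¬ (pdom f).Countable

open Classical in
/-- The restriction of a partial function to a set. -/
noncomputable def prestrict (f : Omega1 → Option ℕ) (Y : Set Omega1) : Omega1 → Option ℕ :=
  fun α => if α ∈ Y then f α else none

/-! ### The notion of forcing and safe families -/

section Family

variable {ι : Type u} {X : ι → Type u} [∀ ξ, TopologicalSpace (X ξ)]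

/-- The section `{x ∈ X_ξ : a(ξ, x) = 1}` of a partial function `a` into `2`. -/
def oneSet (a : (Σ ξ, X ξ) → Option (Fin 2)) (ξ : ι) : Set (X ξ) := {x | a ⟨ξ, x⟩ = some 1}

/-- Conditions: pairs `(a, Φ)` of a countable partial function `a` from `{(ξ, x) : x ∈ X_ξ}` to `2`
and a countable set `Φ` of pairs `(v, f)` with `v` a finite set of indices and `f` a promise. -/
structure Condition (S : ∀ ξ, SpaceData (X ξ)) where
  a : (Σ ξ, X ξ) → Option (Fin 2)
  a_countable : {z | ∃ i, a z = some i}.Countable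
  closure_notMem : ∀ ξ, closure (oneSet a ξ) ∉ (S ξ).U
  Φ : Set (Finset ι × (Omega1 → Option ℕ))
  Φ_countable : Φ.Countable
  Φ_promise : ∀ w ∈ Φ, IsPromise w.2

namespace Condition

variable {S : ∀ ξ, SpaceData (X ξ)}

/-- The set `[p]_ξ`. -/
def sec (p : Condition S) (ξ : ι) : Set (X ξ) := oneSet p.a ξ

/-- The set `Y(v, f, q, p)`. -/
def Y (v : Finset ι) (f : Omega1 → Option ℕ) (q p : Condition S) : Set Omega1 :=
  {α | ∃ n, f α = some n ∧ ∀ ξ ∈ v, q.sec ξ \ p.sec ξ ⊆ (S ξ).B α n}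

/-- `q` extends `p`. -/
def Extends (q p : Condition S) : Prop :=
  (∀ z i, p.a z = some i → q.a z = some i) ∧ p.Φ ⊆ q.Φ ∧
    ∀ v f, (v, f) ∈ p.Φ → ¬ (Y v f q p).Countable ∧ (v, prestrict f (Y v f q p)) ∈ q.Φ

theorem Extends.sec_subset {q p : Condition S} (h : Extends q p) (ξ : ι) :
    p.sec ξ ⊆ q.sec ξ :=
  fun x hx => h.1 ⟨ξ, x⟩ 1 hx

theorem Y_self (v : Finset ι) (f : Omega1 → Option ℕ) (p : Condition S) :
    Y v f p p = pdom f := by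
  ext α
  simp [Y, pdom]

theorem prestrict_pdom (f : Omega1 → Option ℕ) : prestrict f (pdom f) = f := by
  funext α
  unfold prestrict
  split_ifs with h
  · rfl
  · cases hf : f α with
    | none => rfl
    | some n => exact absurd ⟨n, hf⟩ h

theorem extends_refl (p : Condition S) : Extends p p := by
  refine ⟨fun _ _ h => h, subset_rfl, fun v f h => ?_⟩
  rw [Y_self, prestrict_pdom]
  exact ⟨p.Φ_promise _ h, h⟩

theorem Y_trans {r q p : Condition S} (h₁ : Extends r q) (h₂ : Extends q p)
    (v : Finset ι) (f : Omega1 → Option ℕ) :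
    Y v (prestrict f (Y v f q p)) r q = Y v f r p := by
  ext α
  constructor
  · rintro ⟨n, hn, hrq⟩
    unfold prestrict at hn
    split_ifs at hn with hα
    obtain ⟨m, hm, hqp⟩ := hα
    obtain rfl : m = n := by simpa [hm] using hn
    refine ⟨m, hm, fun ξ hξ x hx => ?_⟩
    by_cases hxq : x ∈ q.sec ξ
    · exact hqp ξ hξ ⟨hxq, hx.2⟩
    · exact hrq ξ hξ ⟨hx.1, hxq⟩
  · rintro ⟨n, hn, hrp⟩
    have hα : α ∈ Y v f q p :=
      ⟨n, hn, fun ξ hξ x hx => hrp ξ hξ ⟨h₁.sec_subset ξ hx.1, hx.2⟩⟩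
    refine ⟨n, by simp [prestrict, hα, hn], fun ξ hξ x hx => hrp ξ hξ ⟨hx.1, fun hp => ?_⟩⟩
    exact hx.2 (h₂.sec_subset ξ hp)

theorem prestrict_Y_trans {r q p : Condition S} (h₁ : Extends r q)
    (v : Finset ι) (f : Omega1 → Option ℕ) :
    prestrict (prestrict f (Y v f q p)) (Y v f r p) = prestrict f (Y v f r p) := by
  funext α
  by_cases hα : α ∈ Y v f r p
  · have hα' : α ∈ Y v f q p := by
      obtain ⟨n, hn, hrp⟩ := hα
      exact ⟨n, hn, fun ξ hξ x hx => hrp ξ hξ ⟨h₁.sec_subset ξ hx.1, hx.2⟩⟩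
    simp [prestrict, hα, hα']
  · simp [prestrict, hα]

theorem extends_trans {r q p : Condition S} (h₁ : Extends r q) (h₂ : Extends q p) :
    Extends r p := by
  refine ⟨fun z i h => h₁.1 z i (h₂.1 z i h), h₂.2.1.trans h₁.2.1, fun v f h => ?_⟩
  have key := h₁.2.2 v _ (h₂.2.2 v f h).2
  rwa [Y_trans h₁ h₂, prestrict_Y_trans h₁] at key

/-- The notion of forcing: `q ≤ p` means that `q` extends `p`. -/
instance : Preorder (Condition S) where
  le := Extends
  le_refl := extends_refl
  le_trans := fun _ _ _ h₁ h₂ => extends_trans h₁ h₂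

end Condition

variable (S : ∀ ξ, SpaceData (X ξ))

/-- The filter of closed subsets of `X_v = ∏_{ξ ∈ v} X_ξ` generated by the products
`∏_{ξ ∈ v} A_ξ` with `A_ξ ∈ U_ξ`. -/
def productFilter (v : Finset ι) : Set (Set (∀ ξ : v, X ξ)) :=
  {C | IsClosed C ∧ ∃ A : ∀ ξ : v, Set (X ξ), (∀ ξ : v, A ξ ∈ (S ξ).U) ∧ univ.pi A ⊆ C}

/-- The set of points of `X_v` that are banned by `(v, f)`. -/
def banned (v : Finset ι) (f : Omega1 → Option ℕ) : Set (∀ ξ : v, X ξ) :=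
  {x | {α | ∃ n, f α = some n ∧ ∀ ξ : v, x ξ ∈ (S ξ).B α n}.Countable}

/-- `v` is dangerous. -/
def IsDangerous (v : Finset ι) : Prop :=
  ∃ f, IsPromise f ∧ IsLargeFor (productFilter S v) (banned S v f)

/-- The family is safe. -/
def IsSafe : Prop := ∀ v : Finset ι, ¬ IsDangerous S v

end Family

/-! ### Closure properties of `H(lam)` -/

section HereditarySets

variable {lam : Cardinal.{u}}

/-! Let `M` be the countable set of conditions in the submodel. A decreasing sequence in `M` can
lack a lower bound for two reasons only: the closure of some limit section falls into `U`, or a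
promise keeps only countably many `α`. Both are avoided if new points are added ever closer to a
single point `δ` of the diagonal, on finite sets of coordinates that exhaust the supports. Small
neighbourhoods of `δ` have closure outside `U`, and a maximal closed filter does not contain the
union of two closed sets outside it. If no promise bans `δ`, small neighbourhoods of `δ` fit into
uncountably many prescribed ones (`exists_lower_bound`).

It remains to meet dense sets near `δ` while staying in `M`. For given `p` and dense `D`, only
countably many `α` have a neighbourhood that cannot hold the new points of an extension of `p` in
`D`: otherwise these neighbourhoods form a promise, and adding it to `p` before entering `D` is
contradictory (`countable_not_exists_near`). Safety says that a promise bans only countably many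
diagonal points (`IsSafe.countable_banned`), which makes the diagonal hereditarily separable
(`IsSafe.exists_countable_dense`). Hence countably many extensions of `p` serve all but countably
many `δ` at once (`exists_countable_capture`), and `M` contains them once it is closed under a
suitable operation, before `δ` is known.

The existence of such an operation is first-order over `H(lam)`, so an elementary submodel contains
one and is closed under it (`totallyProper_of_capturesDecisions`). -/

theorem mem_HSet_of_mem {x y : ZFSet.{u}} (hx : x ∈ HSet lam) (hy : y ∈ x) : y ∈ HSet lam := by
  obtain ⟨t, ht, hxt, hc⟩ := hx
  exact ⟨t, ht, ht.subset_of_mem (hxt hy), hc⟩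

theorem mem_HSet_of_subset {x y : ZFSet.{u}} (hx : x ∈ HSet lam) (hy : y ⊆ x) :
    y ∈ HSet lam := by
  obtain ⟨t, ht, hxt, hc⟩ := hx
  exact ⟨t, ht, fun _ hz => hxt (hy hz), hc⟩

/-- This yields a threshold for `lam` above which a given set belongs to `H(lam)`. -/
theorem mem_HSet_of_card_vonNeumann_lt {x : ZFSet.{u}}
    (h : (ZFSet.vonNeumann x.rank).card < lam) : x ∈ HSet lam :=
  ⟨_, ZFSet.isTransitive_vonNeumann _, ZFSet.subset_vonNeumann_self x, h⟩

/-- `H(lam)` is closed under countable subsets when `lam` is regular and uncountable. -/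
theorem range_mem_HSet (hreg : lam.IsRegular) (hlam : Cardinal.aleph0 < lam) {α : Type u}
    [Countable α] {f : α → ZFSet.{u}} (hf : ∀ i, f i ∈ HSet lam) :
    ZFSet.range f ∈ HSet lam := by
  choose t ht hft hc using hf
  have hα : Cardinal.mk α < lam := Cardinal.mk_le_aleph0.trans_lt hlam
  refine ⟨ZFSet.range f ∪ ZFSet.iUnion t, ?_, fun z hz => ZFSet.mem_union.2 (Or.inl hz), ?_⟩
  · intro y hy z hz
    refine ZFSet.mem_union.2 (Or.inr ?_)
    rcases ZFSet.mem_union.1 hy with hy | hy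
    · obtain ⟨i, rfl⟩ := ZFSet.mem_range.1 hy
      exact ZFSet.mem_iUnion.2 ⟨i, hft i hz⟩
    · obtain ⟨i, hi⟩ := ZFSet.mem_iUnion.1 hy
      exact ZFSet.mem_iUnion.2 ⟨i, (ht i).subset_of_mem hi hz⟩
  · refine ZFSet.card_union_le.trans_lt (Cardinal.add_lt_of_lt hreg.1 ?_ ?_)
    · refine lt_of_le_of_lt ?_ hα
      simpa using ZFSet.lift_card_range_le (f := f)
    · refine lt_of_le_of_lt ?_ (Cardinal.sum_lt_of_isRegular hreg hα hc)
      simpa using ZFSet.lift_card_iUnion_le_sum_card (f := t)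

theorem unorderedPair_mem_HSet (hreg : lam.IsRegular) (hlam : Cardinal.aleph0 < lam)
    {x y : ZFSet.{u}} (hx : x ∈ HSet lam) (hy : y ∈ HSet lam) :
    ({x, y} : ZFSet.{u}) ∈ HSet lam := by
  have h : ({x, y} : ZFSet.{u}) = ZFSet.range (fun b : ULift.{u} Bool => cond b.down x y) := by
    ext z
    simp [eq_comm, or_comm]
  rw [h]
  refine range_mem_HSet hreg hlam ?_
  rintro ⟨_ | _⟩ <;> assumption

theorem singleton_mem_HSet (hreg : lam.IsRegular) (hlam : Cardinal.aleph0 < lam)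
    {x : ZFSet.{u}} (hx : x ∈ HSet lam) : ({x} : ZFSet.{u}) ∈ HSet lam := by
  rw [← ZFSet.pair_eq_singleton]
  exact unorderedPair_mem_HSet hreg hlam hx hx

theorem pair_mem_HSet (hreg : lam.IsRegular) (hlam : Cardinal.aleph0 < lam)
    {x y : ZFSet.{u}} (hx : x ∈ HSet lam) (hy : y ∈ HSet lam) : ZFSet.pair x y ∈ HSet lam :=
  unorderedPair_mem_HSet hreg hlam (singleton_mem_HSet hreg hlam hx)
    (unorderedPair_mem_HSet hreg hlam hx hy)

theorem mem_HSet_of_pair_mem_HSet {x y : ZFSet.{u}} (h : ZFSet.pair x y ∈ HSet lam) :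
    x ∈ HSet lam ∧ y ∈ HSet lam := by
  have h' : ({x, y} : ZFSet.{u}) ∈ HSet lam := mem_HSet_of_mem h (by simp [ZFSet.pair])
  exact ⟨mem_HSet_of_mem h' (by simp), mem_HSet_of_mem h' (by simp)⟩

end HereditarySets

/-! ### Relations definable over `H(lam)` -/

section Definability

open FirstOrder

/-- The sequence `x, v 0, v 1, …`. -/
def consVar {M : Type*} (x : M) (v : ℕ → M) : ℕ → M
  | 0 => x
  | i + 1 => v i

/-- Existential quantification of the variable `0`. -/
noncomputable def existsZero (φ : setLang.Formula ℕ) : setLang.Formula ℕ :=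
  (φ.relabel (consVar (Sum.inr ()) Sum.inl) : setLang.Formula (ℕ ⊕ Unit)).iExs Unit

theorem realize_existsZero {M : Type*} [setLang.Structure M] (φ : setLang.Formula ℕ)
    (v : ℕ → M) : (existsZero φ).Realize v ↔ ∃ x, φ.Realize (consVar x v) := by
  have h : ∀ i : Unit → M,
      Sum.elim v i ∘ consVar (Sum.inr ()) Sum.inl = consVar (i ()) v := by
    intro i
    funext n
    cases n <;> rfl
  simp only [existsZero, Language.Formula.realize_iExs, Language.Formula.realize_relabel, h]
  exact ⟨fun ⟨i, hi⟩ => ⟨i (), hi⟩, fun ⟨x, hx⟩ => ⟨fun _ => x, hx⟩⟩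

/-- A context: a type of assignments of elements of `H(lam)` to variables. -/
class VarContext (lam : outParam Cardinal.{u}) (Γ : Type*) where
  var : ℕ → Γ → HSet lam

variable {lam : Cardinal.{u}} {Γ : Type*}

instance instVarContextHSet : VarContext lam (HSet lam) := ⟨fun _ x => x⟩

instance instVarContextProd [VarContext lam Γ] : VarContext lam (Γ × HSet lam) :=
  ⟨fun i g => consVar g.2 (fun j => VarContext.var j g.1) i⟩

variable [VarContext lam Γ]

/-- The relation `R` is first-order definable over `H(lam)` without parameters. -/
def IsDef (R : Γ → Prop) : Prop :=
  ∃ φ : setLang.Formula ℕ, ∀ g, φ.Realize (fun i => VarContext.var (lam := lam) i g) ↔ R g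

/-- `t` is one of the variables of the context. -/
def IsVar (t : Γ → HSet lam) : Prop := ∃ i, ∀ g, VarContext.var i g = t g

theorem isVar_snd : IsVar (fun g : Γ × HSet lam => g.2) := ⟨0, fun _ => rfl⟩

theorem IsVar.comp_fst {t : Γ → HSet lam} (h : IsVar t) :
    IsVar (fun g : Γ × HSet lam => t g.1) :=
  h.imp' Nat.succ fun _ hi g => hi g.1

theorem IsDef.not {R : Γ → Prop} (h : IsDef R) : IsDef fun g => ¬ R g := by
  obtain ⟨φ, hφ⟩ := h
  exact ⟨φ.not, fun g => by rw [Language.Formula.realize_not, hφ]⟩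

theorem IsDef.imp {R T : Γ → Prop} (h : IsDef R) (h' : IsDef T) : IsDef fun g => R g → T g := by
  obtain ⟨φ, hφ⟩ := h
  obtain ⟨ψ, hψ⟩ := h'
  exact ⟨φ.imp ψ, fun g => by rw [Language.Formula.realize_imp, hφ, hψ]⟩

theorem IsDef.congr {R T : Γ → Prop} (h : IsDef R) (e : ∀ g, R g ↔ T g) : IsDef T :=
  Exists.imp (fun _ hφ g => (hφ g).trans (e g)) h

theorem IsDef.and {R T : Γ → Prop} (h : IsDef R) (h' : IsDef T) : IsDef fun g => R g ∧ T g :=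
  (h.imp h'.not).not.congr fun g => by tauto

theorem IsDef.or {R T : Γ → Prop} (h : IsDef R) (h' : IsDef T) : IsDef fun g => R g ∨ T g :=
  (h.not.imp h').congr fun g => by tauto

theorem IsDef.iff {R T : Γ → Prop} (h : IsDef R) (h' : IsDef T) : IsDef fun g => (R g ↔ T g) :=
  ((h.imp h').and (h'.imp h)).congr fun g => by tauto

theorem IsDef.exists {R : Γ → HSet lam → Prop} (h : IsDef fun g : Γ × HSet lam => R g.1 g.2) :
    IsDef fun g => ∃ x, R g x := by
  obtain ⟨φ, hφ⟩ := h
  refine ⟨existsZero φ, fun g => ?_⟩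
  rw [realize_existsZero]
  exact exists_congr fun x => hφ (g, x)

theorem IsDef.forall {R : Γ → HSet lam → Prop} (h : IsDef fun g : Γ × HSet lam => R g.1 g.2) :
    IsDef fun g => ∀ x, R g x :=
  (IsDef.exists (R := fun g x => ¬ R g x) h.not).not.congr fun g => by simp

theorem isDef_mem {s t : Γ → HSet lam} (hs : IsVar s) (ht : IsVar t) :
    IsDef fun g => (s g : ZFSet.{u}) ∈ (t g : ZFSet.{u}) := by
  obtain ⟨i, hi⟩ := hs
  obtain ⟨j, hj⟩ := ht
  let r : setLang.Relations 2 := MemRel.mem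
  refine ⟨r.formula₂ (Language.Term.var i) (Language.Term.var j), fun g => ?_⟩
  rw [Language.Formula.realize_rel₂]
  beta_reduce
  rw [← hi, ← hj]
  exact Iff.rfl

theorem isDef_eq {s t : Γ → HSet lam} (hs : IsVar s) (ht : IsVar t) :
    IsDef fun g => (s g : ZFSet.{u}) = (t g : ZFSet.{u}) := by
  obtain ⟨i, hi⟩ := hs
  obtain ⟨j, hj⟩ := ht
  refine ⟨(Language.Term.var i).equal (Language.Term.var j), fun g => ?_⟩
  rw [Language.Formula.realize_equal]
  beta_reduce
  rw [← hi, ← hj]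
  exact Subtype.ext_iff

/-- `H(lam)` is transitive, so extensionality can be tested on its own elements. -/
theorem isDef_eq_unorderedPair {s t z : Γ → HSet lam} (hs : IsVar s) (ht : IsVar t)
    (hz : IsVar z) : IsDef fun g => (z g : ZFSet.{u}) = {(s g : ZFSet.{u}), (t g : ZFSet.{u})} := by
  refine IsDef.congr (R := fun g => ∀ x : HSet lam, (x : ZFSet.{u}) ∈ (z g : ZFSet.{u}) ↔
    (x : ZFSet.{u}) = s g ∨ (x : ZFSet.{u}) = t g) ?_ fun g => ?_
  · exact (IsDef.iff (isDef_mem isVar_snd hz.comp_fst)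
      ((isDef_eq isVar_snd hs.comp_fst).or (isDef_eq isVar_snd ht.comp_fst))).forall
  · constructor
    · intro h
      ext x
      rw [ZFSet.mem_pair]
      constructor
      · exact fun hx => (h ⟨x, mem_HSet_of_mem (z g).2 hx⟩).1 hx
      · rintro (rfl | rfl)
        · exact (h (s g)).2 (Or.inl rfl)
        · exact (h (t g)).2 (Or.inr rfl)
    · intro h x
      rw [h, ZFSet.mem_pair]

theorem isDef_eq_pair {s t z : Γ → HSet lam} (hs : IsVar s) (ht : IsVar t)
    (hz : IsVar z) : IsDef fun g => (z g : ZFSet.{u}) = ZFSet.pair (s g) (t g) := by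
  refine IsDef.congr (R := fun g => ∃ a b : HSet lam,
    (a : ZFSet.{u}) = {(s g : ZFSet.{u}), (s g : ZFSet.{u})} ∧
    (b : ZFSet.{u}) = {(s g : ZFSet.{u}), (t g : ZFSet.{u})} ∧
    (z g : ZFSet.{u}) = {(a : ZFSet.{u}), (b : ZFSet.{u})}) ?_ fun g => ?_
  · refine IsDef.exists (IsDef.exists ((isDef_eq_unorderedPair ?_ ?_ ?_).and
      ((isDef_eq_unorderedPair ?_ ?_ ?_).and (isDef_eq_unorderedPair ?_ ?_ ?_))))
    · exact hs.comp_fst.comp_fst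
    · exact hs.comp_fst.comp_fst
    · exact isVar_snd.comp_fst
    · exact hs.comp_fst.comp_fst
    · exact ht.comp_fst.comp_fst
    · exact isVar_snd
    · exact isVar_snd.comp_fst
    · exact isVar_snd
    · exact hz.comp_fst.comp_fst
  · constructor
    · rintro ⟨a, b, ha, hb, h⟩
      rw [h, ha, hb, ZFSet.pair_eq_singleton, ZFSet.pair]
    · intro h
      have hz := (z g).2
      rw [h, ZFSet.pair] at hz
      refine ⟨⟨_, mem_HSet_of_mem hz (ZFSet.mem_pair.2 (Or.inl rfl))⟩,
        ⟨_, mem_HSet_of_mem hz (ZFSet.mem_pair.2 (Or.inr rfl))⟩, ?_, rfl, h⟩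
      rw [ZFSet.pair_eq_singleton]

theorem isDef_pair_mem {s t z : Γ → HSet lam} (hs : IsVar s) (ht : IsVar t)
    (hz : IsVar z) : IsDef fun g => ZFSet.pair (s g) (t g) ∈ (z g : ZFSet.{u}) := by
  refine IsDef.congr (R := fun g => ∃ a : HSet lam, (a : ZFSet.{u}) ∈ (z g : ZFSet.{u}) ∧
    (a : ZFSet.{u}) = ZFSet.pair (s g) (t g)) ?_ fun g => ?_
  · exact IsDef.exists ((isDef_mem isVar_snd hz.comp_fst).and
      (isDef_eq_pair hs.comp_fst ht.comp_fst isVar_snd))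
  · constructor
    · rintro ⟨a, ha, h⟩
      rwa [← h]
    · exact fun h => ⟨⟨_, mem_HSet_of_mem (z g).2 h⟩, h, rfl⟩

theorem isDef_pair_pair_mem {s t s' t' z : Γ → HSet lam} (hs : IsVar s) (ht : IsVar t)
    (hs' : IsVar s') (ht' : IsVar t') (hz : IsVar z) :
    IsDef fun g => ZFSet.pair (ZFSet.pair (s g) (t g)) (ZFSet.pair (s' g) (t' g)) ∈
      (z g : ZFSet.{u}) := by
  refine IsDef.congr (R := fun g => ∃ a b : HSet lam, (a : ZFSet.{u}) = ZFSet.pair (s g) (t g) ∧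
    (b : ZFSet.{u}) = ZFSet.pair (s' g) (t' g) ∧
    ZFSet.pair a b ∈ (z g : ZFSet.{u})) ?_ fun g => ?_
  · refine IsDef.exists (IsDef.exists ((isDef_eq_pair ?_ ?_ ?_).and
      ((isDef_eq_pair ?_ ?_ ?_).and (isDef_pair_mem ?_ ?_ ?_))))
    · exact hs.comp_fst.comp_fst
    · exact ht.comp_fst.comp_fst
    · exact isVar_snd.comp_fst
    · exact hs'.comp_fst.comp_fst
    · exact ht'.comp_fst.comp_fst
    · exact isVar_snd
    · exact isVar_snd.comp_fst
    · exact isVar_snd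
    · exact hz.comp_fst.comp_fst
  · constructor
    · rintro ⟨a, b, ha, hb, h⟩
      rwa [← ha, ← hb]
    · intro h
      obtain ⟨ha, hb⟩ := mem_HSet_of_pair_mem_HSet (mem_HSet_of_mem (z g).2 h)
      exact ⟨⟨_, ha⟩, ⟨_, hb⟩, rfl, rfl, h⟩

/-- Elementarity: a definable relation with parameters in `N` that is satisfied by some element
of `H(lam)` is satisfied by some element of `N`. -/
theorem exists_mem_of_isDef (N : setLang.ElementarySubstructure (HSet lam))
    {R : Γ → HSet lam → Prop} (h : IsDef fun g : Γ × HSet lam => R g.1 g.2) (g : Γ)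
    (hg : ∀ i, VarContext.var i g ∈ N) (hex : ∃ x, R g x) : ∃ x ∈ N, R g x := by
  obtain ⟨φ, hφ⟩ := h
  let v : ℕ → N := fun i => ⟨VarContext.var i g, hg i⟩
  have hv : (existsZero φ).Realize (N.subtype ∘ v) := by
    rw [realize_existsZero]
    obtain ⟨x, hx⟩ := hex
    exact ⟨x, (hφ (g, x)).2 hx⟩
  rw [N.subtype.map_formula, realize_existsZero] at hv
  obtain ⟨x, hx⟩ := hv
  refine ⟨x, x.2, (hφ (g, x)).1 ?_⟩
  rw [← N.subtype.map_formula] at hx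
  convert hx using 1
  funext i
  cases i <;> rfl

end Definability

/-! ### A combinatorial criterion for total properness -/

section Criterion

/-- Every countable set is covered by the forward orbit of a given point under some map. -/
theorem exists_iterate_cover {α : Type*} {C : Set α} (hC : C.Countable) (p : α) :
    ∃ g : α → α, ∀ x ∈ C, ∃ k, g^[k] p = x := by
  classical
  suffices h : ∃ e : ℕ → α, C ⊆ range e ∧ e 0 = p ∧ ∃ g : α → α, ∀ k, g (e k) = e (k + 1) by
    obtain ⟨e, hCe, he, g, hg⟩ := h
    have hk : ∀ k, g^[k] p = e k := by
      intro k
      induction k with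
      | zero => exact he.symm
      | succ k ih => rw [Function.iterate_succ_apply', ih, hg]
    refine ⟨g, fun x hx => ?_⟩
    obtain ⟨k, rfl⟩ := hCe hx
    exact ⟨k, hk k⟩
  let C' : Set α := insert p C
  have hC' : C'.Countable := hC.insert p
  have : Countable C' := hC'.to_subtype
  let p' : C' := ⟨p, mem_insert _ _⟩
  -- A finite set is enumerated cyclically, so that `e (k + 1)` is a function of `e k`; an infinite
  -- one bijectively. The swap moves `p` to position `0`.
  rcases finite_or_infinite C' with hfin | hinf
  · obtain ⟨n, ⟨e₀⟩⟩ := Finite.exists_equiv_fin C'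
    have : NeZero n := ⟨by rintro rfl; exact (e₀ p').elim0⟩
    let e : C' ≃ Fin n := e₀.trans (Equiv.swap (e₀ p') 0)
    have he : e p' = 0 := by simp [e]
    refine ⟨fun k => e.symm (Fin.ofNat n k), fun x hx => ?_, ?_,
      fun x => if hx : x ∈ C' then e.symm (e ⟨x, hx⟩ + 1) else x, fun k => ?_⟩
    · refine ⟨e ⟨x, mem_insert_of_mem _ hx⟩, ?_⟩
      simp
    · have h0 : Fin.ofNat n 0 = e p' := he.symm
      show (e.symm (Fin.ofNat n 0) : α) = p
      rw [h0, Equiv.symm_apply_apply]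
    · simp only [Subtype.coe_prop, dif_pos, Subtype.coe_eta, Equiv.apply_symm_apply]
      congr 2
      ext
      simp [Fin.val_add]
  · obtain ⟨e₀⟩ : Nonempty (C' ≃ ℕ) := nonempty_equiv_of_countable
    let e : C' ≃ ℕ := e₀.trans (Equiv.swap (e₀ p') 0)
    have he : e p' = 0 := by simp [e]
    refine ⟨fun k => e.symm k, fun x hx => ?_, ?_,
      fun x => if hx : x ∈ C' then e.symm (e ⟨x, hx⟩ + 1) else x, fun k => ?_⟩
    · exact ⟨e ⟨x, mem_insert_of_mem _ hx⟩, by simp⟩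
    · show (e.symm 0 : α) = p
      rw [← he, Equiv.symm_apply_apply]
    · simp

variable {lam : Cardinal.{u}}

/-- The first-order property of `F` that yields generic sequences: for every countable set `M`
closed under the ternary operation with graph `F`, every `p ∈ M` in the notion of forcing `Pc` has
an extension that decides every element of `M` by means of some condition in `M`. -/
def IsClosureWitness (Pc F : HSet lam) : Prop :=
  ∃ A R W : HSet lam, (Pc : ZFSet.{u}) = ZFSet.pair A R ∧
    (∃ n : HSet lam, (n : ZFSet.{u}) ∈ (W : ZFSet.{u})) ∧
    (∀ m : HSet lam, (m : ZFSet.{u}) ∈ (W : ZFSet.{u}) →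
      ∃ n : HSet lam, (n : ZFSet.{u}) ∈ (W : ZFSet.{u}) ∧ (m : ZFSet.{u}) ∈ (n : ZFSet.{u})) ∧
    ∀ M : HSet lam,
      (∃ e : HSet lam, ∀ m : HSet lam, (m : ZFSet.{u}) ∈ (M : ZFSet.{u}) →
        ∃ n : HSet lam, (n : ZFSet.{u}) ∈ (W : ZFSet.{u}) ∧
          ZFSet.pair n m ∈ (e : ZFSet.{u}) ∧
          ∀ m' : HSet lam, ZFSet.pair n m' ∈ (e : ZFSet.{u}) → (m' : ZFSet.{u}) = m) →
      (∀ D p q : HSet lam, (D : ZFSet.{u}) ∈ (M : ZFSet.{u}) → (p : ZFSet.{u}) ∈ (M : ZFSet.{u}) →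
        (q : ZFSet.{u}) ∈ (M : ZFSet.{u}) →
        (∃ r : HSet lam,
          ZFSet.pair (ZFSet.pair D p) (ZFSet.pair q r) ∈ (F : ZFSet.{u})) →
        ∃ r : HSet lam, (r : ZFSet.{u}) ∈ (M : ZFSet.{u}) ∧
          ZFSet.pair (ZFSet.pair D p) (ZFSet.pair q r) ∈ (F : ZFSet.{u})) →
      ∀ p : HSet lam, (p : ZFSet.{u}) ∈ (M : ZFSet.{u}) → (p : ZFSet.{u}) ∈ (A : ZFSet.{u}) →
        ∃ q : HSet lam, (q : ZFSet.{u}) ∈ (A : ZFSet.{u}) ∧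
          ZFSet.pair q p ∈ (R : ZFSet.{u}) ∧
          ∀ D : HSet lam, (D : ZFSet.{u}) ∈ (M : ZFSet.{u}) →
            (∀ x : HSet lam, (x : ZFSet.{u}) ∈ (D : ZFSet.{u}) →
              (x : ZFSet.{u}) ∈ (A : ZFSet.{u})) →
            ∃ r : HSet lam, (r : ZFSet.{u}) ∈ (M : ZFSet.{u}) ∧
              (r : ZFSet.{u}) ∈ (A : ZFSet.{u}) ∧ ZFSet.pair q r ∈ (R : ZFSet.{u}) ∧
              ((r : ZFSet.{u}) ∈ (D : ZFSet.{u}) ∨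
                ∀ s : HSet lam, (s : ZFSet.{u}) ∈ (D : ZFSet.{u}) →
                  ¬ ZFSet.pair s r ∈ (R : ZFSet.{u}))

theorem isDef_isClosureWitness :
    IsDef fun g : HSet lam × HSet lam => IsClosureWitness g.1 g.2 := by
  unfold IsClosureWitness
  repeat' first
    | with_reducible refine IsDef.exists ?_
    | with_reducible refine IsDef.and ?_ ?_
    | with_reducible refine IsDef.or ?_ ?_
    | with_reducible refine isDef_pair_pair_mem ?_ ?_ ?_ ?_ ?_
    | with_reducible refine isDef_pair_mem ?_ ?_ ?_
    | with_reducible refine isDef_mem ?_ ?_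
    | with_reducible refine isDef_eq_pair ?_ ?_ ?_
    | with_reducible refine isDef_eq ?_ ?_
    | with_reducible refine IsDef.not ?_
    | with_reducible refine IsDef.imp ?_ ?_
    | with_reducible refine IsDef.forall ?_
    -- Variables are counted outwards from the innermost quantifier; the largest index needed is
    -- that of `F` under eight quantifiers.
    | exact ⟨0, fun _ => rfl⟩
    | exact ⟨1, fun _ => rfl⟩
    | exact ⟨2, fun _ => rfl⟩
    | exact ⟨3, fun _ => rfl⟩
    | exact ⟨4, fun _ => rfl⟩
    | exact ⟨5, fun _ => rfl⟩
    | exact ⟨6, fun _ => rfl⟩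
    | exact ⟨7, fun _ => rfl⟩
    | exact ⟨8, fun _ => rfl⟩

end Criterion

/-! ### Codes in the universe of sets and transfer to elementary submodels -/

section Criterion

variable {lam : Cardinal.{u}} {P : Type u}

theorem mem_submodelSets {N : setLang.ElementarySubstructure (HSet lam)} {x : ZFSet.{u}} :
    x ∈ submodelSets N ↔ ∃ h : x ∈ HSet lam, (⟨x, h⟩ : HSet lam) ∈ N := by
  constructor
  · rintro ⟨y, hy, rfl⟩
    exact ⟨y.2, hy⟩
  · rintro ⟨h, hN⟩
    exact ⟨_, hN, rfl⟩

theorem mem_codeSubset {c : P → ZFSet.{u}} {D : Set P} {x : ZFSet.{u}} :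
    x ∈ codeSubset c D ↔ ∃ p ∈ D, c p = x := by
  simp [codeSubset]

theorem code_mem_codeSubset {c : P → ZFSet.{u}} (hc : Function.Injective c) {D : Set P} {p : P} :
    c p ∈ codeSubset c D ↔ p ∈ D := by
  rw [mem_codeSubset]
  exact ⟨fun ⟨q, hq, h⟩ => hc h ▸ hq, fun h => ⟨p, h, rfl⟩⟩

theorem codeSubset_injective {c : P → ZFSet.{u}} (hc : Function.Injective c) :
    Function.Injective (codeSubset c) := by
  intro D E h
  ext p
  rw [← code_mem_codeSubset hc, h, code_mem_codeSubset hc]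

theorem codeSubset_preimage {c : P → ZFSet.{u}} {D : ZFSet.{u}}
    (hD : ∀ x ∈ D, x ∈ codeSubset c univ) : codeSubset c {p | c p ∈ D} = D := by
  ext x
  rw [mem_codeSubset]
  constructor
  · rintro ⟨p, hp, rfl⟩
    exact hp
  · intro hx
    obtain ⟨p, -, rfl⟩ := mem_codeSubset.1 (hD x hx)
    exact ⟨p, hx, rfl⟩

/-- The code of the order of a notion of forcing. -/
noncomputable def codeOrder [Preorder P] (c : P → ZFSet.{u}) : ZFSet.{u} :=
  ZFSet.range (fun r : {r : P × P // r.1 ≤ r.2} => ZFSet.pair (c r.1.1) (c r.1.2))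

theorem codeForcing_eq_pair [Preorder P] (c : P → ZFSet.{u}) :
    codeForcing c = ZFSet.pair (codeSubset c univ) (codeOrder c) := rfl

theorem pair_mem_codeOrder [Preorder P] {c : P → ZFSet.{u}} (hc : Function.Injective c) {p q : P} :
    ZFSet.pair (c p) (c q) ∈ codeOrder c ↔ p ≤ q := by
  rw [codeOrder, ZFSet.mem_range]
  constructor
  · rintro ⟨⟨⟨a, b⟩, hab⟩, h⟩
    obtain ⟨h₁, h₂⟩ := ZFSet.pair_inj.1 h
    rw [← hc h₁, ← hc h₂]
    exact hab
  · exact fun h => ⟨⟨(p, q), h⟩, rfl⟩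

/-- The graph of a ternary operation `g`, as a set. -/
noncomputable def codeOperation (c : P → ZFSet.{u}) (g : Set P → P → P → P) : ZFSet.{u} :=
  ZFSet.range (fun t : Set P × P × P =>
    ZFSet.pair (ZFSet.pair (codeSubset c t.1) (c t.2.1))
      (ZFSet.pair (c t.2.2) (c (g t.1 t.2.1 t.2.2))))

theorem mem_codeOperation {c : P → ZFSet.{u}} (hc : Function.Injective c)
    {g : Set P → P → P → P} {D : Set P} {p q : P} {r : ZFSet.{u}} :
    ZFSet.pair (ZFSet.pair (codeSubset c D) (c p)) (ZFSet.pair (c q) r) ∈ codeOperation c g ↔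
      r = c (g D p q) := by
  rw [codeOperation, ZFSet.mem_range]
  constructor
  · rintro ⟨⟨D', p', q'⟩, h⟩
    simp only [ZFSet.pair_inj] at h
    obtain ⟨⟨h₁, h₂⟩, h₃, h₄⟩ := h
    rw [← h₄, codeSubset_injective hc h₁, hc h₂, hc h₃]
  · rintro rfl
    exact ⟨(D, p, q), rfl⟩

/-- `Q` captures deciding conditions: whenever the countable sets `M` of conditions and `𝒟` of sets
of conditions are closed under `Q`, every `p ∈ M` has an extension `q` such that every `D ∈ 𝒟` is
decided by some `r ∈ M` above `q`. -/
def CapturesDecisions [Preorder P] (Q : Set P → P → Set P) : Prop :=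
  ∀ (M : Set P) (𝒟 : Set (Set P)), M.Countable → 𝒟.Countable →
    (∀ D ∈ 𝒟, ∀ p ∈ M, Q D p ⊆ M) →
    ∀ p ∈ M, ∃ q ≤ p, ∀ D ∈ 𝒟, ∃ r ∈ M, q ≤ r ∧ (r ∈ D ∨ ∀ s ∈ D, ¬ s ≤ r)

/-- A set closed under the graph of `g` contains the orbit of `p` under `g D p`, hence all of `Q D
p`; so `CapturesDecisions` applies to it. -/
theorem isClosureWitness_codeOperation [Preorder P] (hreg : lam.IsRegular)
    (hlam : Cardinal.aleph0 < lam) {c : P → ZFSet.{u}} (hc : Function.Injective c)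
    {Q : Set P → P → Set P} (hQ : CapturesDecisions Q) {g : Set P → P → P → P}
    (hg : ∀ D p, ∀ x ∈ Q D p, ∃ k, (g D p)^[k] p = x)
    (hPc : codeForcing c ∈ HSet lam) (hF : codeOperation c g ∈ HSet lam) :
    IsClosureWitness (⟨_, hPc⟩ : HSet lam) ⟨_, hF⟩ := by
  obtain ⟨hA, hR⟩ := mem_HSet_of_pair_mem_HSet (codeForcing_eq_pair c ▸ hPc)
  -- The iterated singletons of `∅` play the role of `ω`: they form a countable `W`, so a set whose
  -- elements receive distinct labels from `W` is countable.
  let w : ℕ → ZFSet.{u} := fun n => Nat.rec ∅ (fun _ x => {x}) n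
  have hw : ∀ n, w n ∈ HSet lam := by
    intro n
    induction n with
    | zero => exact mem_HSet_of_subset hPc (ZFSet.empty_subset _)
    | succ n ih => exact singleton_mem_HSet hreg hlam ih
  let W : ZFSet.{u} := ZFSet.range (fun n : ULift.{u} ℕ => w n.down)
  have hW : W ∈ HSet lam := range_mem_HSet hreg hlam fun n => hw n.down
  refine ⟨⟨_, hA⟩, ⟨_, hR⟩, ⟨W, hW⟩, rfl, ⟨⟨w 0, hw 0⟩, ZFSet.mem_range.2 ⟨⟨0⟩, rfl⟩⟩, ?_, ?_⟩
  · rintro ⟨m, hm⟩ hmW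
    obtain ⟨n, rfl⟩ := ZFSet.mem_range.1 hmW
    exact ⟨⟨w (n.down + 1), hw (n.down + 1)⟩, ZFSet.mem_range.2 ⟨⟨n.down + 1⟩, rfl⟩,
      ZFSet.mem_singleton.2 rfl⟩
  rintro ⟨M, hM⟩ ⟨e, he⟩ hclosed ⟨p', hp'⟩ hpM hpA
  have hMc : {x | x ∈ M}.Countable := by
    choose n hnW hne hn using fun m : {x // x ∈ M} => he ⟨m, mem_HSet_of_mem hM m.2⟩ m.2
    have hWc : {x | x ∈ W}.Countable := by
      refine (countable_range fun k => w k).mono ?_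
      intro x hx
      obtain ⟨k, rfl⟩ := ZFSet.mem_range.1 hx
      exact ⟨k.down, rfl⟩
    have : Countable {x | x ∈ W} := hWc.to_subtype
    refine Function.Injective.countable (f := fun m : {x | x ∈ M} =>
      (⟨n m, hnW m⟩ : {x | x ∈ W})) ?_
    intro a b hab
    have h : (n a : ZFSet.{u}) = n b := by simpa using hab
    refine Subtype.ext (hn b ⟨a, mem_HSet_of_mem hM a.2⟩ ?_)
    rw [← h]
    exact hne a
  have hclosed' : ∀ D : Set P, codeSubset c D ∈ M → ∀ p q : P, c p ∈ M → c q ∈ M →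
      c (g D p q) ∈ M := by
    intro D hD p q hp hq
    have hex : ZFSet.pair (ZFSet.pair (codeSubset c D) (c p)) (ZFSet.pair (c q) (c (g D p q))) ∈
        codeOperation c g := (mem_codeOperation hc).2 rfl
    have hr := (mem_HSet_of_pair_mem_HSet
      (mem_HSet_of_pair_mem_HSet (mem_HSet_of_mem hF hex)).2).2
    obtain ⟨r, hrM, hrF⟩ := hclosed ⟨_, mem_HSet_of_mem hM hD⟩ ⟨_, mem_HSet_of_mem hM hp⟩
      ⟨_, mem_HSet_of_mem hM hq⟩ hD hp hq ⟨⟨_, hr⟩, hex⟩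
    exact (mem_codeOperation hc).1 hrF ▸ hrM
  obtain ⟨p, -, rfl⟩ := mem_codeSubset.1 hpA
  obtain ⟨q, hqp, hq⟩ := hQ {p | c p ∈ M} {D | codeSubset c D ∈ M} (hMc.preimage hc)
    (hMc.preimage (codeSubset_injective hc)) (by
      intro D hD p hp x hx
      obtain ⟨k, rfl⟩ := hg D p x hx
      clear hx
      induction k with
      | zero => exact hp
      | succ k ih =>
        rw [Function.iterate_succ_apply']
        exact hclosed' D hD p _ hp ih) p hpM
  have hcH : ∀ p, c p ∈ codeSubset c univ := fun p => (code_mem_codeSubset hc).2 (mem_univ p)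
  refine ⟨⟨c q, mem_HSet_of_mem hA (hcH q)⟩, hcH q, (pair_mem_codeOrder hc).2 hqp, ?_⟩
  rintro ⟨D, hD⟩ hDM hDA
  have hD' : codeSubset c {p | c p ∈ D} = D :=
    codeSubset_preimage fun x hx => hDA ⟨x, mem_HSet_of_mem hD hx⟩ hx
  obtain ⟨r, hrM, hqr, hr⟩ := hq {p | c p ∈ D} (by rw [mem_ofPred_eq, hD']; exact hDM)
  refine ⟨⟨c r, mem_HSet_of_mem hM hrM⟩, hrM, hcH r, (pair_mem_codeOrder hc).2 hqr, ?_⟩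
  refine hr.imp id fun h s hs hsr => ?_
  obtain ⟨s', -, hs'⟩ := mem_codeSubset.1 (hDA s hs)
  rw [← hs'] at hsr hs
  exact h s' hs ((pair_mem_codeOrder hc).1 hsr)

/-- A function `w : ℕ → ZFSet` with `w n ∈ w (n + 1)` for all `n` is injective. -/
theorem injective_of_mem_succ {w : ℕ → ZFSet.{u}} (h : ∀ n, w n ∈ w (n + 1)) :
    Function.Injective w := by
  have hm : StrictMono fun n => (w n).rank := strictMono_nat_of_lt_succ fun n =>
    ZFSet.rank_lt_of_mem (h n)
  exact fun a b hab => hm.injective (congrArg ZFSet.rank hab)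

/-- If a closure witness belongs to `N`, then the conditions in `N` have extensions that decide
every set of conditions in `N`. -/
theorem IsClosureWitness.exists_deciding [Preorder P] (hreg : lam.IsRegular)
    (hlam : Cardinal.aleph0 < lam) {c : P → ZFSet.{u}} (hc : Function.Injective c)
    {N : setLang.ElementarySubstructure (HSet lam)} (hN : (submodelSets N).Countable)
    {Pc F : HSet lam} (hPc : (Pc : ZFSet.{u}) = codeForcing c) (hF : F ∈ N)
    (h : IsClosureWitness Pc F) {p : P} (hp : c p ∈ submodelSets N) :
    ∃ q ≤ p, ∀ D : Set P, codeSubset c D ∈ submodelSets N →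
      ∃ r, c r ∈ submodelSets N ∧ q ≤ r ∧ (r ∈ D ∨ ∀ s ∈ D, ¬ s ≤ r) := by
  obtain ⟨A, R, W, hAR, ⟨n₀, hn₀⟩, hsucc, hW⟩ := h
  rw [hPc, codeForcing_eq_pair, ZFSet.pair_inj] at hAR
  obtain ⟨hA, hR⟩ := hAR
  obtain ⟨en, hen⟩ := hN.exists_eq_range ⟨_, hp⟩
  have henH : ∀ n, en n ∈ HSet lam := fun n =>
    (mem_submodelSets.1 (hen ▸ mem_range_self n : en n ∈ submodelSets N)).1
  choose! next hnext hmem using hsucc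
  -- Nothing is known about this `W` except that its elements continue into membership chains. Such
  -- a chain is injective by foundation, which suffices to label the elements of `N`.
  let w : ℕ → HSet lam := fun n => Nat.rec (motive := fun _ => HSet lam) n₀ (fun _ x => next x) n
  have hwW : ∀ n, (w n : ZFSet.{u}) ∈ (W : ZFSet.{u}) := by
    intro n
    induction n with
    | zero => exact hn₀
    | succ n ih => exact hnext _ ih
  have hwinj : Function.Injective fun n => (w n).1 :=
    injective_of_mem_succ (w := fun n => (w n).1) fun n => hmem _ (hwW n)
  have hMmem : ∀ x : ZFSet.{u}, x ∈ ZFSet.range (fun n : ULift.{u} ℕ => en n.down) ↔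
      x ∈ submodelSets N := by
    intro x
    rw [ZFSet.mem_range, hen]
    exact ⟨fun ⟨n, hn⟩ => ⟨n.down, hn⟩, fun ⟨n, hn⟩ => ⟨⟨n⟩, hn⟩⟩
  -- `M` is the set of all elements of `N`; being countable, it belongs to `H(lam)`.
  have key := hW ⟨ZFSet.range (fun n : ULift.{u} ℕ => en n.down),
    range_mem_HSet hreg hlam fun n => henH n.down⟩ ?_ ?_
  · have hpA : c p ∈ codeSubset c univ := (code_mem_codeSubset hc).2 (mem_univ p)
    obtain ⟨⟨q', hq'⟩, hqA, hqp, hq⟩ := key ⟨c p, (mem_submodelSets.1 hp).1⟩ ((hMmem _).2 hp)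
      (hA ▸ hpA)
    rw [← hA] at hqA
    obtain ⟨q, -, rfl⟩ := mem_codeSubset.1 hqA
    refine ⟨q, (pair_mem_codeOrder hc).1 (hR ▸ hqp), fun D hD => ?_⟩
    obtain ⟨⟨r', hr'⟩, hrM, hrA, hqr, hr⟩ := hq ⟨_, (mem_submodelSets.1 hD).1⟩ ((hMmem _).2 hD) (by
      intro x hx
      obtain ⟨d, -, hd⟩ := mem_codeSubset.1 hx
      rw [← hA, ← hd]
      exact (code_mem_codeSubset hc).2 (mem_univ d))
    rw [← hA] at hrA
    obtain ⟨r, -, rfl⟩ := mem_codeSubset.1 hrA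
    refine ⟨r, (hMmem _).1 hrM, (pair_mem_codeOrder hc).1 (hR ▸ hqr), ?_⟩
    refine hr.imp (code_mem_codeSubset hc).1 fun h s hs hsr => ?_
    have hsD := (code_mem_codeSubset hc).2 hs
    refine h ⟨c s, mem_HSet_of_mem (mem_submodelSets.1 hD).1 hsD⟩ hsD ?_
    rw [← hR]
    exact (pair_mem_codeOrder hc).2 hsr
  · refine ⟨⟨ZFSet.range (fun n : ULift.{u} ℕ => ZFSet.pair (w n.down) (en n.down)),
      range_mem_HSet hreg hlam fun n => pair_mem_HSet hreg hlam (w n.down).2 (henH n.down)⟩, ?_⟩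
    intro m hm
    obtain ⟨k, hk⟩ := ZFSet.mem_range.1 hm
    refine ⟨w k.down, hwW _, ZFSet.mem_range.2 ⟨k, by rw [hk]⟩, fun m' hm' => ?_⟩
    obtain ⟨j, hj⟩ := ZFSet.mem_range.1 hm'
    obtain ⟨h₁, h₂⟩ := ZFSet.pair_inj.1 hj
    have hjk : j.down = k.down := hwinj h₁
    rw [← h₂, ← hk, hjk]
  · intro D p q hD hp hq hex
    have hmemN : ∀ x : HSet lam,
        (x : ZFSet.{u}) ∈ ZFSet.range (fun n : ULift.{u} ℕ => en n.down) → x ∈ N := fun x hx =>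
      (mem_submodelSets.1 ((hMmem _).1 hx)).2
    -- `N` is closed under `F` by elementarity, as `F` and the arguments belong to `N`.
    obtain ⟨r, hrN, hr⟩ := exists_mem_of_isDef N
      (R := fun (g : ((HSet lam × HSet lam) × HSet lam) × HSet lam) r =>
        ZFSet.pair (ZFSet.pair g.1.1.2 g.1.2) (ZFSet.pair g.2 r) ∈ (g.1.1.1 : ZFSet.{u}))
      (isDef_pair_pair_mem ⟨3, fun _ => rfl⟩ ⟨2, fun _ => rfl⟩ ⟨1, fun _ => rfl⟩
        ⟨0, fun _ => rfl⟩ ⟨4, fun _ => rfl⟩) (((F, D), p), q)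
      (by
        rintro (_ | _ | _ | _)
        exacts [hmemN _ hq, hmemN _ hp, hmemN _ hD, hF]) hex
    exact ⟨r, (hMmem _).2 ⟨r, hrN, rfl⟩, hr⟩

theorem codeOrder_mem_submodelSets [Preorder P] {c : P → ZFSet.{u}}
    {N : setLang.ElementarySubstructure (HSet lam)} (h : codeForcing c ∈ submodelSets N) :
    codeOrder c ∈ submodelSets N := by
  obtain ⟨hP, hPN⟩ := mem_submodelSets.1 h
  obtain ⟨hA, hR⟩ := mem_HSet_of_pair_mem_HSet (codeForcing_eq_pair c ▸ hP)
  obtain ⟨x, hxN, A, hx⟩ := exists_mem_of_isDef N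
    (R := fun (g : HSet lam) x => ∃ A : HSet lam, (g : ZFSet.{u}) = ZFSet.pair A x)
    (IsDef.exists (isDef_eq_pair ⟨0, fun _ => rfl⟩ ⟨1, fun _ => rfl⟩ ⟨2, fun _ => rfl⟩))
    ⟨_, hP⟩ (fun _ => hPN) ⟨⟨_, hR⟩, ⟨_, hA⟩, rfl⟩
  exact ⟨x, hxN, ((ZFSet.pair_inj.1 hx).2).symm⟩

/-- Separation inside `N`. Deciding `D ∩ Iic a` instead of `D` is what keeps the generic sequence
decreasing. -/
theorem codeSubset_inter_Iic_mem_submodelSets [Preorder P] {c : P → ZFSet.{u}}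
    (hc : Function.Injective c) {N : setLang.ElementarySubstructure (HSet lam)}
    (h : codeForcing c ∈ submodelSets N) {D : Set P} (hD : codeSubset c D ∈ submodelSets N)
    {a : P} (ha : c a ∈ submodelSets N) : codeSubset c (D ∩ Iic a) ∈ submodelSets N := by
  obtain ⟨hRH, hRN⟩ := mem_submodelSets.1 (codeOrder_mem_submodelSets h)
  obtain ⟨hDH, hDN⟩ := mem_submodelSets.1 hD
  obtain ⟨haH, haN⟩ := mem_submodelSets.1 ha
  have hE : ∀ s : ZFSet.{u}, s ∈ codeSubset c (D ∩ Iic a) ↔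
      s ∈ codeSubset c D ∧ ZFSet.pair s (c a) ∈ codeOrder c := by
    intro s
    constructor
    · intro hs
      obtain ⟨p, ⟨hpD, hpa⟩, rfl⟩ := mem_codeSubset.1 hs
      exact ⟨(code_mem_codeSubset hc).2 hpD, (pair_mem_codeOrder hc).2 hpa⟩
    · rintro ⟨hs, hsa⟩
      obtain ⟨p, hpD, rfl⟩ := mem_codeSubset.1 hs
      exact (code_mem_codeSubset hc).2 ⟨hpD, (pair_mem_codeOrder hc).1 hsa⟩
  obtain ⟨x, hxN, hx⟩ := exists_mem_of_isDef N
    (R := fun (g : (HSet lam × HSet lam) × HSet lam) x => ∀ s : HSet lam,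
      (s : ZFSet.{u}) ∈ (x : ZFSet.{u}) ↔
        (s : ZFSet.{u}) ∈ (g.1.2 : ZFSet.{u}) ∧ ZFSet.pair s g.2 ∈ (g.1.1 : ZFSet.{u}))
    (IsDef.forall (IsDef.iff (isDef_mem ⟨0, fun _ => rfl⟩ ⟨1, fun _ => rfl⟩)
      ((isDef_mem ⟨0, fun _ => rfl⟩ ⟨3, fun _ => rfl⟩).and
        (isDef_pair_mem ⟨0, fun _ => rfl⟩ ⟨2, fun _ => rfl⟩ ⟨4, fun _ => rfl⟩))))
    ((⟨_, hRH⟩, ⟨_, hDH⟩), ⟨_, haH⟩)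
    (by
      rintro (_ | _ | _)
      exacts [haN, hDN, hRN])
    ⟨⟨_, mem_HSet_of_subset hDH fun s hs => ((hE s).1 hs).1⟩, fun s => hE s⟩
  refine ⟨x, hxN, ?_⟩
  ext s
  constructor
  · exact fun hs => (hE s).2 ((hx ⟨s, mem_HSet_of_mem x.2 hs⟩).1 hs)
  · intro hs
    have hs' := (hE s).1 hs
    exact (hx ⟨s, mem_HSet_of_mem hDH hs'.1⟩).2 hs'

/-- For large `lam` the operation coding `Q` is a closure witness in `H(lam)`; it need not lie in
`N`, but elementarity supplies some witness that does. This gives one `q` that decides every set in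
`N`, and the generic sequence is then built from conditions of `N` above `q`. -/
theorem totallyProper_of_capturesDecisions [Preorder P] {Q : Set P → P → Set P}
    (hQc : ∀ D p, (Q D p).Countable) (hQ : CapturesDecisions Q) : TotallyProper P := by
  intro c hc
  choose g hg using fun D p => exists_iterate_cover (hQc D p) p
  refine ⟨max (Order.succ Cardinal.aleph0)
    (Order.succ (ZFSet.vonNeumann (codeOperation c g).rank).card), ?_⟩
  intro lam hle hreg N hN hPN p hp
  have hlam : Cardinal.aleph0 < lam := Order.succ_le_iff.1 ((le_max_left _ _).trans hle)
  have hFH : codeOperation c g ∈ HSet lam :=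
    mem_HSet_of_card_vonNeumann_lt (Order.succ_le_iff.1 ((le_max_right _ _).trans hle))
  obtain ⟨hPH, hPN'⟩ := mem_submodelSets.1 hPN
  obtain ⟨F, hFN, hF⟩ := exists_mem_of_isDef N (R := fun g x => IsClosureWitness g x)
    isDef_isClosureWitness ⟨_, hPH⟩ (fun _ => hPN')
    ⟨_, isClosureWitness_codeOperation hreg hlam hc hQ hg hPH hFH⟩
  obtain ⟨q, hqp, hq⟩ := hF.exists_deciding hreg hlam hc hN rfl hFN hp
  have hstep : ∀ (D : Set P) (a : {a : P // c a ∈ submodelSets N ∧ q ≤ a}),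
      ∃ b : {b : P // c b ∈ submodelSets N ∧ q ≤ b}, b.1 ≤ a.1 ∧
        (IsDenseOpen D → codeSubset c D ∈ submodelSets N → b.1 ∈ D) := by
    rintro D ⟨a, haN, hqa⟩
    by_cases hD : IsDenseOpen D ∧ codeSubset c D ∈ submodelSets N
    · obtain ⟨r, hrN, hqr, hr⟩ := hq (D ∩ Iic a)
        (codeSubset_inter_Iic_mem_submodelSets hc hPN hD.2 haN)
      have hrD : r ∈ D ∩ Iic a := by
        -- Density gives `t ∈ D` below `q`, hence below both `a` and `r`, so the negative decision
        -- is impossible.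
        refine hr.resolve_right fun h => ?_
        obtain ⟨t, htD, htq⟩ := hD.1.1 q
        exact h t ⟨htD, htq.trans hqa⟩ (htq.trans hqr)
      exact ⟨⟨r, hrN, hqr⟩, hrD.2, fun _ _ => hrD.1⟩
    · exact ⟨⟨a, haN, hqa⟩, le_rfl, fun h₁ h₂ => absurd ⟨h₁, h₂⟩ hD⟩
  choose next hnext hmem using hstep
  obtain ⟨E, hE⟩ := countable_iff_exists_subset_range.1 (hN.preimage (codeSubset_injective hc))
  let s : ℕ → {a : P // c a ∈ submodelSets N ∧ q ≤ a} :=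
    fun n => Nat.rec ⟨p, hp, hqp⟩ (fun n a => next (E n) a) n
  refine ⟨fun n => (s n).1, rfl, ⟨fun n => (s n).2.1, fun n => hnext (E n) (s n), ?_⟩,
    q, fun n => (s n).2.2⟩
  intro D hD hDN
  obtain ⟨n, rfl⟩ := hE hDN
  exact ⟨n + 1, hmem (E n) (s n) hD hDN⟩

end Criterion

/-! ### The first uncountable ordinal -/

instance instUncountableOmega1 : Uncountable Omega1 := by
  rw [← Cardinal.aleph0_lt_mk_iff, Cardinal.mk_toType]
  simp

theorem countable_Iio_omega1 (α : Omega1) : (Iio α).Countable := by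
  have h : Cardinal.mk (Iio α) < Cardinal.aleph 1 := by
    have := Cardinal.mk_Iio_lt α (by simp [Cardinal.mk_toType])
    simpa [Cardinal.mk_toType] using this
  rw [Cardinal.lt_aleph_one_iff] at h
  exact Cardinal.mk_le_aleph0_iff.1 h

/-! ### Maximal filters of closed sets -/

section MaximalFilter

variable {X : Type u} [TopologicalSpace X] {U : Set (Set X)}

/-- Otherwise `U` and `A` generate a proper closed filter, and maximality puts `A` into `U`. -/
theorem IsMaximalClosedFilter.exists_disjoint (hU : IsMaximalClosedFilter U) {A : Set X}
    (hA : IsClosed A) (hAU : A ∉ U) : ∃ B ∈ U, Disjoint A B := by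
  by_contra! hcon
  have hV : IsClosedFilter {C : Set X | IsClosed C ∧ ∃ B ∈ U, A ∩ B ⊆ C} := by
    refine ⟨fun C hC => hC.1, ⟨isClosed_univ, univ, hU.1.univ_mem, subset_univ _⟩, ?_, ?_, ?_⟩
    · rintro ⟨-, B, hB, hAB⟩
      exact hcon B hB (disjoint_iff_inter_eq_empty.2 (subset_empty_iff.1 hAB))
    · rintro C ⟨hC, B, hB, hBC⟩ C' ⟨hC', B', hB', hBC'⟩
      exact ⟨hC.inter hC', _, hU.1.inter_mem B hB B' hB', fun x hx =>
        ⟨hBC ⟨hx.1, hx.2.1⟩, hBC' ⟨hx.1, hx.2.2⟩⟩⟩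
    · rintro C ⟨-, B, hB, hBC⟩ C' hC' hCC'
      exact ⟨hC', B, hB, hBC.trans hCC'⟩
  have hVU := hU.2 _ hV fun C hC => ⟨hU.1.isClosed C hC, C, hC, inter_subset_right⟩
  exact hAU (hVU ▸ ⟨hA, univ, hU.1.univ_mem, inter_subset_left⟩)

theorem IsMaximalClosedFilter.union_notMem (hU : IsMaximalClosedFilter U) {A B : Set X}
    (hA : IsClosed A) (hB : IsClosed B) (hAU : A ∉ U) (hBU : B ∉ U) : A ∪ B ∉ U := by
  intro h
  obtain ⟨A', hA', hAA'⟩ := hU.exists_disjoint hA hAU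
  obtain ⟨B', hB', hBB'⟩ := hU.exists_disjoint hB hBU
  refine hU.1.empty_notMem ?_
  have := hU.1.inter_mem _ h _ (hU.1.inter_mem A' hA' B' hB')
  convert this
  symm
  rw [← disjoint_iff_inter_eq_empty, disjoint_union_left]
  exact ⟨hAA'.mono_right inter_subset_left, hBB'.mono_right inter_subset_right⟩

theorem SpaceData.countable_notMem (S : SpaceData X) {A : Set X} (hA : A ∈ S.U) :
    {α | S.y α ∉ A}.Countable := by
  refine ((S.y_diag.2 A hA).preimage S.y_inj).mono ?_
  exact fun α hα => ⟨mem_range_self α, hα⟩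

theorem SpaceData.y_mem_B (S : SpaceData X) (α : Omega1) (n : ℕ) : S.y α ∈ S.B α n :=
  mem_of_mem_nhds ((S.B_basis α).mem n)

/-- Some member of `U` misses the point, as `U` is free, and regularity gives a closed neighbourhood
disjoint from it. -/
theorem SpaceData.exists_closure_B_notMem [RegularSpace X] (S : SpaceData X) (α : Omega1) :
    ∃ k, ∀ n ≥ k, closure (S.B α n) ∉ S.U := by
  have hα : S.y α ∉ ⋂₀ S.U := by simp [S.U_free]
  rw [mem_sInter] at hα
  push Not at hα
  obtain ⟨A, hA, hαA⟩ := hα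
  have hAc : Aᶜ ∈ 𝓝 (S.y α) := (S.U_max.1.isClosed A hA).isOpen_compl.mem_nhds hαA
  obtain ⟨C, hC, hCc, hCA⟩ := exists_mem_nhds_isClosed_subset hAc
  obtain ⟨k, hk⟩ := (S.B_basis α).mem_iff.1 hC
  refine ⟨k, fun n hn h => S.U_max.1.empty_notMem ?_⟩
  have hsub : closure (S.B α n) ⊆ Aᶜ :=
    (closure_minimal (((S.B_basis α).antitone hn).trans hk) hCc).trans hCA
  have := S.U_max.1.inter_mem _ h _ hA
  convert this
  symm
  rw [← disjoint_iff_inter_eq_empty]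
  exact disjoint_compl_left.mono_left hsub

end MaximalFilter

/-! ### Consequences of safety -/

section Safe

variable {ι : Type u} {X : ι → Type u} [∀ ξ, TopologicalSpace (X ξ)] {S : ∀ ξ, SpaceData (X ξ)}

/-- A promise bans only countably many points of the diagonal. -/
theorem IsSafe.countable_banned (hS : IsSafe S) (v : Finset ι) {f : Omega1 → Option ℕ}
    (hf : IsPromise f) : {α | (fun ξ : v => (S ξ).y α) ∈ banned S v f}.Countable := by
  have h : ¬ IsLargeFor (productFilter S v) (banned S v f) := fun h => hS v ⟨f, hf, h⟩
  unfold IsLargeFor at h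
  push Not at h
  obtain ⟨C, ⟨-, A, hA, hAC⟩, hC⟩ := h
  refine (countable_iUnion fun ξ : v => (S ξ).countable_notMem (hA ξ)).mono fun α hα => ?_
  by_contra hcon
  simp only [mem_iUnion, not_exists] at hcon
  have : (fun ξ : v => (S ξ).y α) ∈ banned S v f ∩ C :=
    ⟨hα, hAC fun ξ _ => not_not.1 (hcon ξ)⟩
  rw [hC] at this
  exact this

/-- The diagonal `{(y_α)_{ξ ∈ w} : α < ω₁}` of a finite product is hereditarily separable. -/
theorem IsSafe.exists_countable_dense (hS : IsSafe S) (w : Finset ι) (E : Set Omega1) :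
    ∃ c ⊆ E, c.Countable ∧ ∀ β ∈ E, ∀ n, ∃ α ∈ c, ∀ ξ ∈ w, (S ξ).y α ∈ (S ξ).B β n := by
  classical
  by_contra! hcon
  choose! b hbE m hb using hcon
  -- If no countable subset is dense, recursion along `ω₁` gives a left-separated sequence: the
  -- chosen neighbourhood of `h i` excludes, in some coordinate of `w`, every earlier point.
  let h : Omega1 → Omega1 := WellFoundedLT.fix fun i rec => b {α | ∃ j, ∃ hj : j < i, rec j hj = α}
  have hh : ∀ i, h i = b (h '' Iio i) := by
    intro i
    refine (WellFoundedLT.fix_eq _ i).trans (congrArg b ?_)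
    ext α
    simp only [mem_image, mem_Iio, exists_prop]
    exact Iff.rfl
  have hc : ∀ i, (h '' Iio i).Countable := fun i => (countable_Iio_omega1 i).image h
  have hE : ∀ i, h i ∈ E := by
    intro i
    induction i using WellFoundedLT.induction with
    | ind i ih =>
      rw [hh]
      refine hbE _ ?_ (hc i)
      rintro _ ⟨j, hj, rfl⟩
      exact ih j hj
  have hout : ∀ i j, j < i → ∃ ξ ∈ w, (S ξ).y (h j) ∉ (S ξ).B (h i) (m (h '' Iio i)) := by
    intro i j hj
    rw [hh i]
    refine hb _ ?_ (hc i) _ (mem_image_of_mem h hj)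
    rintro _ ⟨k, -, rfl⟩
    exact hE k
  have hne : ∀ i j, j < i → h j ≠ h i := by
    intro i j hj heq
    obtain ⟨ξ, -, hξ⟩ := hout i j hj
    exact hξ (heq ▸ (S ξ).y_mem_B _ _)
  have hinj : Function.Injective h := by
    intro i j hij
    rcases lt_trichotomy i j with hlt | heq | hlt
    · exact absurd hij (hne j i hlt)
    · exact heq
    · exact absurd hij.symm (hne i j hlt)
  let f : Omega1 → Option ℕ := fun α =>
    if hα : ∃ i, h i = α then some (m (h '' Iio hα.choose)) else none
  have hfh : ∀ i, f (h i) = some (m (h '' Iio i)) := by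
    intro i
    have hi : ∃ j, h j = h i := ⟨i, rfl⟩
    have : hi.choose = i := hinj hi.choose_spec
    simp only [f, dif_pos hi, this]
  have hrange : ¬ (range h).Countable := fun hr => by
    have := hr.preimage hinj
    rw [preimage_range] at this
    exact not_countable_univ this
  have hf : IsPromise f := fun hcount => hrange <| hcount.mono <| by
    rintro _ ⟨i, rfl⟩
    exact ⟨_, hfh i⟩
  -- The promise `f` prescribes these neighbourhoods. The point with index `h j` can lie in the one
  -- prescribed at `h i` only if `i ≤ j`, so all of the uncountably many points are banned.
  refine hrange ((hS.countable_banned w hf).mono ?_)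
  rintro _ ⟨j, rfl⟩
  refine (((countable_Iio_omega1 j).insert j).image h).mono ?_
  rintro α ⟨n, hn, hα⟩
  by_cases hi : ∃ i, h i = α
  · obtain ⟨i, rfl⟩ := hi
    refine ⟨i, ?_, rfl⟩
    by_contra hij
    rw [Iio_insert, mem_Iic, not_le] at hij
    obtain ⟨ξ, hξ, hout'⟩ := hout i j hij
    obtain rfl : m (h '' Iio i) = n := by simpa [hfh i] using hn
    exact hout' (hα ⟨ξ, hξ⟩)
  · simp [f, hi] at hn

end Safe

/-! ### Meeting dense sets close to points of the diagonal -/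

namespace Condition

variable {ι : Type u} {X : ι → Type u} [∀ ξ, TopologicalSpace (X ξ)] {S : ∀ ξ, SpaceData (X ξ)}

/-- Add a promise to a condition. -/
def addPromise (p : Condition S) (v : Finset ι) (f : Omega1 → Option ℕ) (hf : IsPromise f) :
    Condition S where
  a := p.a
  a_countable := p.a_countable
  closure_notMem := p.closure_notMem
  Φ := insert (v, f) p.Φ
  Φ_countable := p.Φ_countable.insert _
  Φ_promise := by
    rintro w (rfl | hw)
    · exact hf
    · exact p.Φ_promise w hw

theorem addPromise_le (p : Condition S) (v : Finset ι) (f : Omega1 → Option ℕ)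
    (hf : IsPromise f) : p.addPromise v f hf ≤ p := by
  have h := extends_refl p
  exact ⟨h.1, subset_insert _ _, fun w g hwg =>
    ⟨(h.2.2 w g hwg).1, mem_insert_of_mem _ (h.2.2 w g hwg).2⟩⟩

/-- A dense set is met below `p` by adding points only close to almost every point of the
diagonal. -/
theorem countable_not_exists_near (p : Condition S) {D : Set (Condition S)}
    (hD : ∀ p, ∃ q ∈ D, q ≤ p) (w : Finset ι) :
    {α | ∃ n, ¬ ∃ q ∈ D, q ≤ p ∧ ∀ ξ ∈ w, q.sec ξ \ p.sec ξ ⊆ (S ξ).B α n}.Countable := by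
  classical
  by_contra hcon
  -- Each bad `α` is promised a neighbourhood that fails for it. An extension in `D` of `p` with
  -- this promise must respect it at some `α`, contrary to the choice of `f α`.
  let f : Omega1 → Option ℕ := fun α =>
    if h : ∃ n, ¬ ∃ q ∈ D, q ≤ p ∧ ∀ ξ ∈ w, q.sec ξ \ p.sec ξ ⊆ (S ξ).B α n
    then some h.choose else none
  have hf : IsPromise f := by
    refine fun hc => hcon (hc.mono ?_)
    exact fun α hα => ⟨_, dif_pos hα⟩
  obtain ⟨q, hqD, hq⟩ := hD (p.addPromise w f hf)
  have hY : ¬ (Y w f q (p.addPromise w f hf)).Countable := (hq.2.2 w f (mem_insert _ _)).1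
  obtain ⟨α, n, hn, hα⟩ : (Y w f q (p.addPromise w f hf)).Nonempty := by
    by_contra he
    exact hY (not_nonempty_iff_eq_empty.1 he ▸ countable_empty)
  by_cases h : ∃ n, ¬ ∃ q ∈ D, q ≤ p ∧ ∀ ξ ∈ w, q.sec ξ \ p.sec ξ ⊆ (S ξ).B α n
  · have hn' : h.choose = n := Option.some_injective _ ((dif_pos h).symm.trans hn)
    refine h.choose_spec ⟨q, hqD, hq.trans (p.addPromise_le w f hf), ?_⟩
    rw [hn']
    exact hα
  · exact absurd ((dif_neg h).symm.trans hn) (by simp)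

/-- Extensions are chosen for all good `α` and all `n`, but by hereditary separability only those
with `α` in a countable dense set are kept: such an `α` near `β` has a basic neighbourhood inside `B
β n`, in all coordinates of `w`. -/
theorem exists_countable_capture (hS : IsSafe S) (p : Condition S) {D : Set (Condition S)}
    (hD : ∀ p, ∃ q ∈ D, q ≤ p) (w : Finset ι) :
    ∃ (Q : Set (Condition S)) (b : Set Omega1), Q.Countable ∧ b.Countable ∧
      ∀ α ∉ b, ∀ n, ∃ q ∈ Q, q ∈ D ∧ q ≤ p ∧ ∀ ξ ∈ w, q.sec ξ \ p.sec ξ ⊆ (S ξ).B α n := by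
  have hb := p.countable_not_exists_near hD w
  set b := {α | ∃ n, ¬ ∃ q ∈ D, q ≤ p ∧ ∀ ξ ∈ w, q.sec ξ \ p.sec ξ ⊆ (S ξ).B α n} with hbdef
  have hex : ∀ α, α ∉ b → ∀ n, ∃ q ∈ D, q ≤ p ∧ ∀ ξ ∈ w, q.sec ξ \ p.sec ξ ⊆ (S ξ).B α n := by
    intro α hα n
    by_contra h
    exact hα ⟨n, h⟩
  have : Nonempty (Condition S) := ⟨p⟩
  choose! q hqD hqp hq using hex
  obtain ⟨c, hcE, hc, hdense⟩ := hS.exists_countable_dense w bᶜ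
  refine ⟨⋃ α ∈ c, range (q α), b, hc.biUnion fun α _ => countable_range _, hb, ?_⟩
  intro β hβ n
  obtain ⟨α, hα, hαβ⟩ := hdense β hβ n
  have hm : ∀ ξ ∈ w, ∃ m, (S ξ).B α m ⊆ (S ξ).B β n := fun ξ hξ => by
    obtain ⟨m, hm⟩ :=
      ((S ξ).B_basis α).mem_iff.1 (((S ξ).B_open β n).mem_nhds (hαβ ξ hξ))
    exact ⟨m, hm⟩
  choose! m hm using hm
  have hαb : α ∉ b := hcE hα
  refine ⟨q α (w.sup m), mem_biUnion hα (mem_range_self _), hqD α hαb _, hqp α hαb _, ?_⟩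
  exact fun ξ hξ => (hq α hαb _ ξ hξ).trans
    ((((S ξ).B_basis α).antitone (Finset.le_sup hξ)).trans (hm ξ hξ))

/-- The indices that occur in a condition. -/
def support (p : Condition S) : Set ι :=
  {ξ | ∃ x i, p.a ⟨ξ, x⟩ = some i} ∪ {ξ | ∃ w ∈ p.Φ, ξ ∈ w.1}

theorem support_countable (p : Condition S) : p.support.Countable := by
  refine Countable.union ?_ ?_
  · refine (p.a_countable.image Sigma.fst).mono ?_
    rintro ξ ⟨x, i, h⟩
    exact ⟨⟨ξ, x⟩, ⟨i, h⟩, rfl⟩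
  · refine (p.Φ_countable.biUnion fun w _ => w.1.countable_toSet).mono ?_
    rintro ξ ⟨w, hw, hξ⟩
    exact mem_biUnion hw hξ

theorem support_mono {p q : Condition S} (h : q ≤ p) : p.support ⊆ q.support := by
  rintro ξ (⟨x, i, hx⟩ | ⟨w, hw, hξ⟩)
  · exact Or.inl ⟨x, i, h.1 _ _ hx⟩
  · exact Or.inr ⟨w, h.2.1 hw, hξ⟩

theorem countable_finset_subset {α : Type*} {s : Set α} (hs : s.Countable) :
    {w : Finset α | (w : Set α) ⊆ s}.Countable := by
  refine ((countable_ofPred_finite_subset hs).preimage Finset.coe_injective).mono ?_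
  exact fun w hw => ⟨w.finite_toSet, hw⟩

/-- The conditions that decide `D`. -/
def deciding (D : Set (Condition S)) : Set (Condition S) := {r | r ∈ D ∨ ∀ s ∈ D, ¬ s ≤ r}

theorem deciding_dense (D : Set (Condition S)) (p : Condition S) : ∃ q ∈ deciding D, q ≤ p := by
  by_cases h : ∃ s ∈ D, s ≤ p
  · obtain ⟨s, hs, hsp⟩ := h
    exact ⟨s, Or.inl hs, hsp⟩
  · push Not at h
    exact ⟨p, Or.inr h, le_rfl⟩

/-- A countable support has countably many finite subsets, so `Q` and `b` can be uniform in `w`.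
Passing to `deciding D`, which is always dense, allows arbitrary `D`. -/
theorem exists_countable_capture_support (hS : IsSafe S) (D : Set (Condition S))
    (p : Condition S) :
    ∃ (Q : Set (Condition S)) (b : Set Omega1), Q.Countable ∧ b.Countable ∧
      ∀ α ∉ b, ∀ w : Finset ι, (w : Set ι) ⊆ p.support → ∀ n, ∃ q ∈ Q, q ∈ deciding D ∧ q ≤ p ∧
        ∀ ξ ∈ w, q.sec ξ \ p.sec ξ ⊆ (S ξ).B α n := by
  choose Q b hQ hb h using exists_countable_capture hS p (deciding_dense D)
  have hc := countable_finset_subset p.support_countable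
  refine ⟨⋃ w ∈ {w : Finset ι | (w : Set ι) ⊆ p.support}, Q w,
    ⋃ w ∈ {w : Finset ι | (w : Set ι) ⊆ p.support}, b w,
    hc.biUnion fun w _ => hQ w, hc.biUnion fun w _ => hb w, fun α hα w hw n => ?_⟩
  obtain ⟨q, hqQ, hq⟩ := h w α (fun hαw => hα (mem_biUnion hw hαw)) n
  exact ⟨q, mem_biUnion hw hqQ, hq⟩

end Condition

/-! ### Fusion at a point of the diagonal -/

namespace Condition

variable {ι : Type u} {X : ι → Type u} [∀ ξ, TopologicalSpace (X ξ)] {S : ∀ ξ, SpaceData (X ξ)}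

/-- If a point of the diagonal is not banned by `(v, f)`, then small neighbourhoods of it are
included in uncountably many of the sets that are prescribed by `f`. -/
theorem exists_not_countable_B_subset {v : Finset ι} {f : Omega1 → Option ℕ} {δ : Omega1}
    (h : (fun ξ : v => (S ξ).y δ) ∉ banned S v f) :
    ∃ k, ∀ n ≥ k, ¬ {α | ∃ m, f α = some m ∧ ∀ ξ ∈ v, (S ξ).B δ n ⊆ (S ξ).B α m}.Countable := by
  by_contra! hcon
  have hk : ∀ k, {α | ∃ m, f α = some m ∧ ∀ ξ ∈ v, (S ξ).B δ k ⊆ (S ξ).B α m}.Countable := by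
    intro k
    obtain ⟨n, hn, hc⟩ := hcon k
    refine hc.mono ?_
    rintro α ⟨m, hm, hα⟩
    exact ⟨m, hm, fun ξ hξ => (((S ξ).B_basis δ).antitone hn).trans (hα ξ hξ)⟩
  -- A prescribed neighbourhood containing the point is open, so some `B δ k` fits into it in all
  -- coordinates of `v`. Countable sets for every `k` would thus make the point banned.
  refine h ((countable_iUnion hk).mono ?_)
  rintro α ⟨m, hm, hα⟩
  have hB : ∀ ξ ∈ v, ∃ k, (S ξ).B δ k ⊆ (S ξ).B α m := fun ξ hξ =>
    ((S ξ).B_basis δ).mem_iff.1 (((S ξ).B_open α m).mem_nhds (hα ⟨ξ, hξ⟩))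
  choose! k hk using hB
  exact mem_iUnion.2 ⟨v.sup k, m, hm, fun ξ hξ =>
    (((S ξ).B_basis δ).antitone (Finset.le_sup hξ)).trans (hk ξ hξ)⟩

/-- A decreasing sequence of conditions has a lower bound if new points are eventually added only
close to a given point of the diagonal, sufficiently close for the promises that have been made. -/
theorem exists_lower_bound (δ : Omega1) {p : ℕ → Condition S} (hp : Antitone p)
    {w : ℕ → Finset ι} (hw : Monotone w) {k : ℕ → ℕ} (hk : Monotone k)
    (hnear : ∀ n, ∀ ξ ∈ w n, (p (n + 1)).sec ξ \ (p n).sec ξ ⊆ (S ξ).B δ (k n))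
    (hclosure : ∀ m, ∀ ξ ∈ (p m).support, ∃ n, ξ ∈ w n ∧ closure ((S ξ).B δ (k n)) ∉ (S ξ).U)
    (hpromise : ∀ m v f, (v, f) ∈ (p m).Φ → ∃ n, v ⊆ w n ∧
      ¬ {α | ∃ i, f α = some i ∧ ∀ ξ ∈ v,
        (p n).sec ξ \ (p m).sec ξ ⊆ (S ξ).B α i ∧ (S ξ).B δ (k n) ⊆ (S ξ).B α i}.Countable) :
    ∃ q : Condition S, ∀ n, q ≤ p n := by
  classical
  -- In the coordinates of `w n`, all points added from stage `n` on lie in `B δ (k n)`.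
  have htail : ∀ n, ∀ ξ ∈ w n, ∀ j, (p j).sec ξ ⊆ (p n).sec ξ ∪ (S ξ).B δ (k n) := by
    intro n ξ hξ j
    rcases le_total j n with hjn | hnj
    · exact (Extends.sec_subset (hp hjn) ξ).trans subset_union_left
    · induction j, hnj using Nat.le_induction with
      | base => exact subset_union_left
      | succ j hnj ih =>
        intro x hx
        by_cases hxj : x ∈ (p j).sec ξ
        · exact ih hxj
        · exact Or.inr (((S ξ).B_basis δ).antitone (hk hnj) (hnear j ξ (hw hnj hξ) ⟨hx, hxj⟩))
  let a : (Σ ξ, X ξ) → Option (Fin 2) := fun z =>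
    if h : ∃ n i, (p n).a z = some i then some h.choose_spec.choose else none
  have ha : ∀ n z i, (p n).a z = some i → a z = some i := by
    intro n z i hi
    have h : ∃ n i, (p n).a z = some i := ⟨n, i, hi⟩
    have h₁ : (p (max n h.choose)).a z = some i := (hp (le_max_left _ _)).1 z i hi
    have h₂ : (p (max n h.choose)).a z = some h.choose_spec.choose :=
      (hp (le_max_right _ _)).1 z _ h.choose_spec.choose_spec
    have h₃ : a z = some h.choose_spec.choose := dif_pos h
    rw [h₃, ← h₂, h₁]
  have ha' : ∀ z i, a z = some i → ∃ n, (p n).a z = some i := by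
    intro z i hi
    by_cases h : ∃ n i, (p n).a z = some i
    · have h₃ : a z = some h.choose_spec.choose := dif_pos h
      exact ⟨h.choose, by rw [← hi, h₃]; exact h.choose_spec.choose_spec⟩
    · exact absurd ((dif_neg h).symm.trans hi) (by simp)
  have hsec : ∀ ξ, ∀ x ∈ oneSet a ξ, ∃ n, x ∈ (p n).sec ξ := fun ξ x hx => ha' _ _ hx
  -- `q₀` fixes the sections of the lower bound. Since `Y` depends on sections only, the restricted
  -- promises are computed from `q₀` and added afterwards, in `q`.
  let q₀ : Condition S :=
    { a := a
      a_countable := by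
        refine (countable_iUnion fun n => (p n).a_countable).mono ?_
        rintro z ⟨i, hi⟩
        obtain ⟨n, hn⟩ := ha' z i hi
        exact mem_iUnion.2 ⟨n, i, hn⟩
      closure_notMem := by
        intro ξ
        -- A coordinate with empty section may be outside every support, where `hclosure` gives
        -- nothing.
        rcases (oneSet a ξ).eq_empty_or_nonempty with he | ⟨x, hx⟩
        · rw [he, closure_empty]
          exact (S ξ).U_max.1.empty_notMem
        · obtain ⟨m, hm⟩ := hsec ξ x hx
          obtain ⟨n, hn, hcl⟩ := hclosure m ξ (Or.inl ⟨x, 1, hm⟩)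
          have hsub : closure (oneSet a ξ) ⊆
              closure ((p n).sec ξ) ∪ closure ((S ξ).B δ (k n)) := by
            rw [← closure_union]
            refine closure_mono fun y hy => ?_
            obtain ⟨j, hj⟩ := hsec ξ y hy
            exact htail n ξ hn j hj
          intro hU
          exact (S ξ).U_max.union_notMem isClosed_closure isClosed_closure
            ((p n).closure_notMem ξ) hcl
            ((S ξ).U_max.1.mem_of_superset _ hU _ (isClosed_closure.union isClosed_closure) hsub)
      Φ := ⋃ n, (p n).Φ
      Φ_countable := countable_iUnion fun n => (p n).Φ_countable
      Φ_promise := by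
        intro w hw
        obtain ⟨n, hn⟩ := mem_iUnion.1 hw
        exact (p n).Φ_promise w hn }
  have hY : ∀ m v f, (v, f) ∈ (p m).Φ → ¬ (Y v f q₀ (p m)).Countable := by
    intro m v f hvf hc
    obtain ⟨n, hvn, hn⟩ := hpromise m v f hvf
    refine hn (hc.mono ?_)
    rintro α ⟨i, hi, hα⟩
    refine ⟨i, hi, fun ξ hξ x hx => ?_⟩
    obtain ⟨j, hj⟩ := hsec ξ x hx.1
    rcases htail n ξ (hvn hξ) j hj with hxn | hxB
    · exact (hα ξ hξ).1 ⟨hxn, hx.2⟩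
    · exact (hα ξ hξ).2 hxB
  have hpdom : ∀ m v f, Y v f q₀ (p m) ⊆ pdom (prestrict f (Y v f q₀ (p m))) := by
    rintro m v f α hα
    obtain ⟨i, hi, -⟩ := id hα
    exact ⟨i, by simp [prestrict, hα, hi]⟩
  let q : Condition S :=
    { q₀ with
      Φ := (⋃ n, (p n).Φ) ∪ ⋃ n, (fun w => (w.1, prestrict w.2 (Y w.1 w.2 q₀ (p n)))) '' (p n).Φ
      Φ_countable := (countable_iUnion fun n => (p n).Φ_countable).union
        (countable_iUnion fun n => (p n).Φ_countable.image _)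
      Φ_promise := by
        rintro w (hw | hw)
        · exact q₀.Φ_promise w hw
        · obtain ⟨n, ⟨v, f⟩, hvf, rfl⟩ := mem_iUnion.1 hw
          exact fun hc => hY n v f hvf (hc.mono (hpdom n v f)) }
  refine ⟨q, fun n => ⟨ha n, ?_, fun v f hvf => ⟨hY n v f hvf, Or.inr ?_⟩⟩⟩
  · exact fun w hw => Or.inl (mem_iUnion.2 ⟨n, hw⟩)
  · exact mem_iUnion.2 ⟨n, (v, f), hvf, rfl⟩

/-- One step of the construction of a generic sequence. -/
theorem exists_fusion_step [∀ ξ, RegularSpace (X ξ)] {M : Set (Condition S)} {δ : Omega1}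
    (hban : ∀ p ∈ M, ∀ w ∈ p.Φ, (fun ξ : w.1 => (S ξ).y δ) ∉ banned S w.1 w.2)
    {D : Set (Condition S)} {p : Condition S} {w : Finset ι} {k : ℕ}
    (hw : (w : Set ι) ⊆ p.support)
    (hcap : ∃ q ∈ M, q ∈ D ∧ q ≤ p ∧ ∀ ξ ∈ w, q.sec ξ \ p.sec ξ ⊆ (S ξ).B δ k)
    (r : Condition S) (v : Finset ι) (f : Omega1 → Option ℕ) (u : Finset ι) :
    ∃ p' ∈ M, ∃ (w' : Finset ι) (k' : ℕ), (w' : Set ι) ⊆ p'.support ∧ p' ≤ p ∧ w ⊆ w' ∧ k ≤ k' ∧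
      p' ∈ D ∧ (∀ ξ ∈ w, p'.sec ξ \ p.sec ξ ⊆ (S ξ).B δ k) ∧
      ((u : Set ι) ⊆ p'.support → ∀ ξ ∈ u, ξ ∈ w' ∧ closure ((S ξ).B δ k') ∉ (S ξ).U) ∧
      (p' ≤ r → (v, f) ∈ r.Φ → v ⊆ w' ∧
        ¬ {α | ∃ i, f α = some i ∧ ∀ ξ ∈ v, p'.sec ξ \ r.sec ξ ⊆ (S ξ).B α i ∧
          (S ξ).B δ k' ⊆ (S ξ).B α i}.Countable) := by
  classical
  obtain ⟨p', hp'M, hp'D, hp'p, hnear⟩ := hcap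
  choose k₁ hk₁ using fun ξ => (S ξ).exists_closure_B_notMem δ
  -- If `p' ≤ r`, the restriction of `f` to `Y v f p' r` is a promise of `p'`, so it does not ban
  -- `δ`; its domain already ensures that the points added between `r` and `p'` fit.
  have hk₂ : ∃ k₂, ∀ n ≥ k₂, p' ≤ r → (v, f) ∈ r.Φ →
      ¬ {α | ∃ i, f α = some i ∧ ∀ ξ ∈ v, p'.sec ξ \ r.sec ξ ⊆ (S ξ).B α i ∧
          (S ξ).B δ n ⊆ (S ξ).B α i}.Countable := by
    by_cases h : p' ≤ r ∧ (v, f) ∈ r.Φ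
    · obtain ⟨k₂, hk₂⟩ :=
        exists_not_countable_B_subset (hban p' hp'M _ (h.1.2.2 v f h.2).2)
      refine ⟨k₂, fun n hn _ _ hc => hk₂ n hn (hc.mono ?_)⟩
      rintro α ⟨m, hm, hα⟩
      simp only [prestrict] at hm
      split_ifs at hm with hαY
      obtain ⟨i, hi, hY⟩ := hαY
      obtain rfl : i = m := by simpa [hi] using hm
      exact ⟨i, hi, fun ξ hξ => ⟨hY ξ hξ, hα ξ hξ⟩⟩
    · exact ⟨0, fun _ _ h₁ h₂ => absurd ⟨h₁, h₂⟩ h⟩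
  obtain ⟨k₂, hk₂⟩ := hk₂
  -- The requests `u` and `v` are served only when they lie in the support of `p'`, because
  -- conditions are captured only for finite subsets of the support.
  refine ⟨p', hp'M, w ∪ ((if (u : Set ι) ⊆ p'.support then u else ∅) ∪
    if (v : Set ι) ⊆ p'.support then v else ∅), max k (max (u.sup k₁) k₂), ?_, hp'p,
    Finset.subset_union_left, le_max_left _ _, hp'D, hnear, ?_, ?_⟩
  · have hite : ∀ u : Finset ι,
        ((if (u : Set ι) ⊆ p'.support then u else ∅ : Finset ι) : Set ι) ⊆ p'.support := by
      intro u
      split_ifs with h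
      · exact h
      · simp
    rw [Finset.coe_union, Finset.coe_union]
    exact union_subset (hw.trans (support_mono hp'p)) (union_subset (hite u) (hite v))
  · intro hu ξ hξ
    refine ⟨?_, hk₁ ξ _ ?_⟩
    · rw [if_pos hu]
      exact Finset.mem_union_right _ (Finset.mem_union_left _ hξ)
    · exact (Finset.le_sup hξ).trans ((le_max_left _ _).trans (le_max_right _ _))
  · intro hr hvf
    have hv : (v : Set ι) ⊆ p'.support := fun ξ hξ => Or.inr ⟨(v, f), hr.2.1 hvf, hξ⟩
    refine ⟨?_, hk₂ _ ((le_max_right _ _).trans (le_max_right _ _)) hr hvf⟩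
    rw [if_pos hv]
    exact fun ξ hξ => Finset.mem_union_right _ (Finset.mem_union_right _ hξ)

/-- A countable set is enumerated with infinite repetitions. -/
theorem exists_enumeration_repeating {α : Type*} [Nonempty α] {s : Set α} (hs : s.Countable) :
    ∃ e : ℕ → α, ∀ x ∈ s, ∀ m, ∃ n ≥ m, e n = x := by
  obtain ⟨e, he⟩ := countable_iff_exists_subset_range.1 hs
  refine ⟨fun n => e n.unpair.1, fun x hx m => ?_⟩
  obtain ⟨i, rfl⟩ := he hx
  exact ⟨Nat.pair i m, Nat.right_le_pair i m, by simp⟩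

/-- Bookkeeping: each step enters one set of the family and serves one finite set of coordinates and
one promise. With infinite repetitions, every request is served at a stage after it has arisen, when
the guards in `exists_fusion_step` hold. -/
theorem exists_fusion [∀ ξ, RegularSpace (X ξ)] {M : Set (Condition S)}
    {𝒟 : Set (Set (Condition S))} (hM : M.Countable) (h𝒟 : 𝒟.Countable) {δ : Omega1}
    (hban : ∀ p ∈ M, ∀ w ∈ p.Φ, (fun ξ : w.1 => (S ξ).y δ) ∉ banned S w.1 w.2)
    (hcap : ∀ D ∈ 𝒟, ∀ p ∈ M, ∀ w : Finset ι, (w : Set ι) ⊆ p.support → ∀ n,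
      ∃ q ∈ M, q ∈ D ∧ q ≤ p ∧ ∀ ξ ∈ w, q.sec ξ \ p.sec ξ ⊆ (S ξ).B δ n)
    {p : Condition S} (hp : p ∈ M) :
    ∃ q ≤ p, ∀ D ∈ 𝒟, ∃ r ∈ M, q ≤ r ∧ r ∈ D := by
  have : Nonempty (Condition S) := ⟨p⟩
  -- `univ` is adjoined to make the enumerated family nonempty; the condition itself captures it.
  have huniv : ∀ p ∈ M, ∀ w : Finset ι, (w : Set ι) ⊆ p.support → ∀ n,
      ∃ q ∈ M, q ∈ univ ∧ q ≤ p ∧ ∀ ξ ∈ w, q.sec ξ \ p.sec ξ ⊆ (S ξ).B δ n :=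
    fun p hp w _ n => ⟨p, hp, mem_univ p, le_rfl, fun ξ _ => by simp⟩
  obtain ⟨eD, heD⟩ := (h𝒟.insert univ).exists_eq_range (insert_nonempty _ _)
  have hcapD : ∀ j, ∀ p ∈ M, ∀ w : Finset ι, (w : Set ι) ⊆ p.support → ∀ n,
      ∃ q ∈ M, q ∈ eD j ∧ q ≤ p ∧ ∀ ξ ∈ w, q.sec ξ \ p.sec ξ ⊆ (S ξ).B δ n := by
    intro j
    rcases (heD ▸ mem_range_self j : eD j ∈ insert univ 𝒟) with h | h
    · rw [h]
      exact huniv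
    · exact hcap _ h
  obtain ⟨eΦ, heΦ⟩ := exists_enumeration_repeating
    (hM.biUnion fun r _ => r.Φ_countable.image fun w => (r, w))
  obtain ⟨eu, heu⟩ := exists_enumeration_repeating
    (countable_finset_subset (hM.biUnion fun r _ => r.support_countable))
  let State := {t : Condition S × Finset ι × ℕ // t.1 ∈ M ∧ (t.2.1 : Set ι) ⊆ t.1.support}
  have hstep : ∀ (n : ℕ) (t : State), ∃ t' : State, t'.1.1 ≤ t.1.1 ∧ t.1.2.1 ⊆ t'.1.2.1 ∧
      t.1.2.2 ≤ t'.1.2.2 ∧ t'.1.1 ∈ eD n ∧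
      (∀ ξ ∈ t.1.2.1, t'.1.1.sec ξ \ t.1.1.sec ξ ⊆ (S ξ).B δ t.1.2.2) ∧
      ((eu n : Set ι) ⊆ t'.1.1.support →
        ∀ ξ ∈ eu n, ξ ∈ t'.1.2.1 ∧ closure ((S ξ).B δ t'.1.2.2) ∉ (S ξ).U) ∧
      (t'.1.1 ≤ (eΦ n).1 → (eΦ n).2 ∈ (eΦ n).1.Φ → (eΦ n).2.1 ⊆ t'.1.2.1 ∧
        ¬ {α | ∃ i, (eΦ n).2.2 α = some i ∧ ∀ ξ ∈ (eΦ n).2.1,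
          t'.1.1.sec ξ \ (eΦ n).1.sec ξ ⊆ (S ξ).B α i ∧
          (S ξ).B δ t'.1.2.2 ⊆ (S ξ).B α i}.Countable) := by
    rintro n ⟨⟨p, w, k⟩, hp, hw⟩
    obtain ⟨p', hp', w', k', hw', h⟩ := exists_fusion_step hban hw (hcapD n p hp w hw k)
      (eΦ n).1 (eΦ n).2.1 (eΦ n).2.2 (eu n)
    exact ⟨⟨(p', w', k'), hp', hw'⟩, h⟩
  choose next hle hwsub hkle hD hnear hclosure hpromise using hstep
  let t : ℕ → State := fun n => Nat.rec (motive := fun _ => State)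
    ⟨(p, ∅, 0), hp, by simp⟩ next n
  have hanti : Antitone fun n => (t n).1.1 := antitone_nat_of_succ_le fun n => hle n (t n)
  have hlower := exists_lower_bound δ (p := fun n => (t n).1.1) hanti
    (w := fun n => (t n).1.2.1) (monotone_nat_of_le_succ fun n => hwsub n (t n))
    (k := fun n => (t n).1.2.2) (monotone_nat_of_le_succ fun n => hkle n (t n))
    (fun n => hnear n (t n)) ?_ ?_
  · obtain ⟨q, hq⟩ := hlower
    refine ⟨q, hq 0, fun D hDmem => ?_⟩
    obtain ⟨n, rfl⟩ : D ∈ range eD := heD ▸ mem_insert_of_mem _ hDmem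
    exact ⟨(t (n + 1)).1.1, (t (n + 1)).2.1, hq (n + 1), hD n (t n)⟩
  · intro m ξ hξ
    obtain ⟨n, hn, heq⟩ := heu {ξ} (by
      have : ξ ∈ ⋃ r ∈ M, r.support := mem_biUnion (t m).2.1 hξ
      simpa using this) m
    refine ⟨n + 1, hclosure n (t n) ?_ ξ (by simp [heq])⟩
    rw [heq, Finset.coe_singleton, singleton_subset_iff]
    exact support_mono (hanti (hn.trans n.le_succ)) hξ
  · intro m v f hvf
    obtain ⟨n, hn, heq⟩ := heΦ ((t m).1.1, (v, f))
      (mem_biUnion (t m).2.1 (mem_image_of_mem _ hvf)) m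
    have h := hpromise n (t n)
    rw [heq] at h
    exact ⟨n + 1, h (hanti (hn.trans n.le_succ)) hvf⟩

/-- Only countably many `δ` are banned by a promise from `M` or exceptional for some `D ∈ 𝒟` and `p
∈ M`. Any other `δ` admits the fusion, as the extensions near it lie in the sets `Q D p ⊆ M`. -/
theorem totallyProper_of_isSafe [∀ ξ, RegularSpace (X ξ)] (hS : IsSafe S) :
    TotallyProper (Condition S) := by
  choose Q b hQ hb hcap using exists_countable_capture_support hS
  refine totallyProper_of_capturesDecisions hQ ?_
  intro M 𝒟 hM h𝒟 hclosed p hp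
  have hbad : ((⋃ D ∈ 𝒟, ⋃ p ∈ M, b D p) ∪ ⋃ p ∈ M, ⋃ w ∈ p.Φ,
      {α | (fun ξ : w.1 => (S ξ).y α) ∈ banned S w.1 w.2}).Countable := by
    refine (h𝒟.biUnion fun D _ => hM.biUnion fun p _ => hb D p).union
      (hM.biUnion fun p _ => p.Φ_countable.biUnion fun w hw => ?_)
    exact hS.countable_banned w.1 (p.Φ_promise w hw)
  obtain ⟨δ, hδ⟩ : ∃ δ, δ ∉ (⋃ D ∈ 𝒟, ⋃ p ∈ M, b D p) ∪ ⋃ p ∈ M, ⋃ w ∈ p.Φ,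
      {α | (fun ξ : w.1 => (S ξ).y α) ∈ banned S w.1 w.2} := by
    by_contra! h
    exact not_countable_univ (hbad.mono fun α _ => h α)
  rw [mem_union, not_or] at hδ
  obtain ⟨q, hqp, hq⟩ := exists_fusion (𝒟 := deciding '' 𝒟) hM (h𝒟.image _) (δ := δ)
    (fun p hp w hw h => hδ.2 (mem_biUnion hp (mem_biUnion hw h))) (by
      rintro _ ⟨D, hD, rfl⟩ p hp w hw n
      obtain ⟨q, hqQ, h⟩ := hcap D p δ
        (fun h => hδ.1 (mem_biUnion hD (mem_biUnion hp h))) w hw n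
      exact ⟨q, hclosed D hD p hp hqQ, h⟩) hp
  refine ⟨q, hqp, fun D hD => ?_⟩
  obtain ⟨r, hrM, hqr, hr⟩ := hq _ (mem_image_of_mem _ hD)
  exact ⟨r, hrM, hqr, hr⟩

end Condition

theorem mainTheorem7 (CH : Cardinal.continuum.{0} = Cardinal.aleph 1)
    {ι : Type u} (X : ι → Type u) [∀ ξ, TopologicalSpace (X ξ)]
    (hX : ∀ ξ, IsRelevant (X ξ)) (S : ∀ ξ, SpaceData (X ξ)) (hS : IsSafe S) :
    TotallyProper (Condition S) := by
  have : ∀ ξ, RegularSpace (X ξ) := fun ξ => (hX ξ).regular.toRegularSpace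
  exact Condition.totallyProper_of_isSafe hS
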